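/- Let $p$ be a prime and let $\mathbb{Q}_p$ carry the Haar measure for which $\mathbb{Z}_p$ has volume $1$. For $a,b\in\mathbb{Q}_p$, $a\neq 0$, put $G(a,b)f(x)=|a|_p^{-1/2}f\left(\frac{x-b}{a}\right)$; this is the action of the affine group. Let $Gf=\{G(a,b)f\}$ be the orbit (as a set of functions) and $G_f=\{(a,b): G(a,b)f=f\}$ the stabilizer of $f$. Elements $n\in\mathbb{Q}_p/\mathbb{Z}_p$ are represented by $n=\sum_{l=-\delta}^{-1}n_lp^l$ with $n_l\in\{0,\dots,p-1\}$. Let $\chi(x)=e^{2\pi i\{x\}}$, where $\{x\}$ is the $p$-adic fractional part, and let $$\psi_{\gamma nj}(x)=p^{-\gamma/2}\,\chi\left(p^{-1}j(p^{\gamma}x-n)\right)\mathbf 1_{\{|p^{\gamma}x-n|_p\le 1\}},\qquad \gamma\in\mathbb{Z},\ n\in\mathbb{Q}_p/\mathbb{Z}_p,\ j=1,\dots,p-1,$$ be the $p$-adic wavelets. Let $D_0(\mathbb{Q}_p)$ be the space of locally constant, compactly supported functions $\mathbb{Q}_p\to\mathbb{C}$ with integral zero. Every $f\in D_0(\mathbb{Q}_p)$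 has a finite expansion $f=\sum C_{\gamma nj}\psi_{\gamma nj}$; $f$ is called generic if $G_f$ is the intersection of the stabilizers of those $\psi_{\gamma nj}$ with $C_{\gamma nj}\neq 0$. A family $(u_i)$ in $L^2(\mathbb{Q}_p)$ is a frame if there are $A,B>0$ with $A\|g\|^2\le\sum_i|\langle g,u_i\rangle|^2\le B\|g\|^2$ for all $g\in L^2(\mathbb{Q}_p)$; it is tight if one can take $A=B$, and uniform if all $\|u_i\|$ are equal. A frame of wavelets is a frame of the form $$\{G(p^{\gamma_1},p^{\gamma_1}n_1)f^{(J_1)}\},\qquad \gamma_1\in\mathbb{Z},\ n_1\in\mathbb{Q}_p/\mathbb{Z}_p,\tag{1}$$ where $\{f^{(J_1)}\}$ is a finite set of mean zero functions in $L^2(\mathbb{Q}_p)$ (the family is indexed by the triples $(\gamma_1,n_1,J_1)$). Proposition. Let $f\in D_0(\mathbb{Q}_p)$ be generic and nonzero. Then either the orbit $Gf$ itself, or some finite number of copies of $Gf$, is a frame of wavelets, and this frame is uniform and tight. More precisely, let $\gamma_0$ be the minimal $\gamma$ occurring with a nonzero coefficient in the wavelet expansion of $f$. 1. If $\gamma_0\le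 1$, there is a finite set $\{f^{(J_1)}\}$ for which (1) is a uniform tight frame of wavelets whose members are pairwise distinct and form exactly the orbit $Gf$. 2. If $\gamma_0>1$, there is a finite set $\{f^{(J_1)}\}$ for which (1) is a uniform tight frame of wavelets in which each element of $Gf$ occurs exactly $p^{\gamma_0-1}$ times, and in which nothing else occurs. -/

import Mathlib

open MeasureTheory

namespace PadicWavelet

noncomputable section

/-- `ℚ_[p]` carries its Borel σ-algebra. -/
instance instMeasurableSpacePadic (p : ℕ) [Fact p.Prime] : MeasurableSpace ℚ_[p] :=
  borel ℚ_[p]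

instance instBorelSpacePadic (p : ℕ) [Fact p.Prime] : BorelSpace ℚ_[p] := ⟨rfl⟩

/-- The closed unit ball `ℤ_p` as a compact set with nonempty interior. -/
def unitBall (p : ℕ) [Fact p.Prime] : TopologicalSpace.PositiveCompacts ℚ_[p] where
  carrier := Metric.closedBall 0 1
  isCompact' := isCompact_closedBall 0 1
  interior_nonempty' :=
    ⟨0, interior_mono Metric.ball_subset_closedBall
      (by rw [Metric.isOpen_ball.interior_eq]; exact Metric.mem_ball_self one_pos)⟩

/-- The Haar measure on `ℚ_[p]`, normalized so that the unit ball has volume `1`. -/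
def haar (p : ℕ) [Fact p.Prime] : Measure ℚ_[p] :=
  Measure.addHaarMeasure (unitBall p)

/-- The chosen representatives of `ℚ_p / ℤ_p`: the numbers `∑_{l=-k}^{-1} n_l p^l` with digits
`n_l ∈ {0, …, p-1}`, that is, the fractions `m / p^k` with `0 ≤ m < p^k`. -/
def FracReps (p : ℕ) : Set ℚ :=
  {q | ∃ k m : ℕ, m < p ^ k ∧ q = (m : ℚ) / (p : ℚ) ^ k}

theorem exists_fracRep (p : ℕ) [Fact p.Prime] (x : ℚ_[p]) :
    ∃ q ∈ FracReps p, ‖x - (q : ℚ_[p])‖ ≤ 1 := by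
  have hp0 : (p : ℚ_[p]) ≠ 0 := by exact_mod_cast (Fact.out : p.Prime).ne_zero
  have hp1 : (1 : ℝ) < p := by exact_mod_cast (Fact.out : p.Prime).one_lt
  obtain ⟨k, hk⟩ := pow_unbounded_of_one_lt ‖x‖ hp1
  have hpk : (0 : ℝ) < (p : ℝ) ^ k := by positivity
  have hy : ‖(p : ℚ_[p]) ^ k * x‖ ≤ 1 := by
    rw [norm_mul, norm_pow, Padic.norm_p, inv_pow, inv_mul_le_iff₀ hpk, mul_one]
    exact hk.le
  obtain ⟨y, hyx⟩ : ∃ y : ℤ_[p], (y : ℚ_[p]) = (p : ℚ_[p]) ^ k * x := ⟨⟨_, hy⟩, rfl⟩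
  refine ⟨(y.appr k : ℚ) / (p : ℚ) ^ k, ⟨k, y.appr k, y.appr_lt k, rfl⟩, ?_⟩
  obtain ⟨c, hc⟩ := Ideal.mem_span_singleton.mp (PadicInt.appr_spec k y)
  have hc' : (p : ℚ_[p]) ^ k * x - (y.appr k : ℚ_[p]) = (p : ℚ_[p]) ^ k * (c : ℚ_[p]) := by
    have := congrArg (fun z : ℤ_[p] => (z : ℚ_[p])) hc
    simpa [hyx] using this
  have : x - (((y.appr k : ℚ) / (p : ℚ) ^ k : ℚ) : ℚ_[p]) = (c : ℚ_[p]) := by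
    push_cast
    field_simp
    linear_combination hc'
  rw [this]
  exact c.2

/-- The fractional part `{x} = ∑_{l<0} x_l p^l` of a `p`-adic number `x = ∑ x_l p^l`: the
representative of its class in `ℚ_p / ℤ_p`. -/
def fracPart (p : ℕ) [Fact p.Prime] (x : ℚ_[p]) : ℚ := (exists_fracRep p x).choose

/-- The additive character `χ(x) = exp(2πi {x})`. -/
def chi (p : ℕ) [Fact p.Prime] (x : ℚ_[p]) : ℂ :=
  Complex.exp (2 * Real.pi * Complex.I * (fracPart p x : ℂ))

/-- Indices `(γ, n, j)` of the wavelet basis: `γ ∈ ℤ`, `n ∈ ℚ_p / ℤ_p`, `j = 1, …, p - 1`. -/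
abbrev WaveletIndex (p : ℕ) : Type := ℤ × FracReps p × Set.Ico 1 p

open Classical in
/-- The wavelet `ψ_{γ n j}(x) = p^{-γ/2} χ(p⁻¹ j (p^γ x - n)) Ω(|p^γ x - n|_p)`. -/
def wavelet (p : ℕ) [Fact p.Prime] (i : WaveletIndex p) (x : ℚ_[p]) : ℂ :=
  if ‖(p : ℚ_[p]) ^ i.1 * x - ((i.2.1 : ℚ) : ℚ_[p])‖ ≤ 1 then
    (((p : ℝ) ^ (-(i.1 : ℝ) / 2) : ℝ) : ℂ) *
      chi p ((p : ℚ_[p])⁻¹ * ((i.2.2 : ℕ) : ℚ_[p]) *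
        ((p : ℚ_[p]) ^ i.1 * x - ((i.2.1 : ℚ) : ℚ_[p])))
  else 0

/-- The finite wavelet sum `∑ C_{γ n j} ψ_{γ n j}`. -/
def waveletSum (p : ℕ) [Fact p.Prime] (C : WaveletIndex p →₀ ℂ) (x : ℚ_[p]) : ℂ :=
  ∑ i ∈ C.support, C i * wavelet p i x

/-- The space `D_0(ℚ_p)`: locally constant, compactly supported, of mean zero. -/
def MeanZeroTestFunctions (p : ℕ) [Fact p.Prime] : Set (ℚ_[p] → ℂ) :=
  {f | IsLocallyConstant f ∧ HasCompactSupport f ∧ ∫ x, f x ∂(haar p) = 0}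

/-- The action `G(a,b) f(x) = |a|_p^{-1/2} f((x - b)/a)` of the affine group, whose elements are
the pairs `(a, b)` with `a ≠ 0`. -/
def G {p : ℕ} [Fact p.Prime] (a : ℚ_[p]ˣ) (b : ℚ_[p]) (f : ℚ_[p] → ℂ) (x : ℚ_[p]) : ℂ :=
  ((‖(a : ℚ_[p])‖ ^ (-(1 / 2) : ℝ) : ℝ) : ℂ) * f ((x - b) / (a : ℚ_[p]))

/-- The stabilizer of `f` in the affine group. -/
def stabilizer {p : ℕ} [Fact p.Prime] (f : ℚ_[p] → ℂ) : Set (ℚ_[p]ˣ × ℚ_[p]) :=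
  {g | G g.1 g.2 f = f}

/-- The orbit of `f` under the affine group. -/
def orbit {p : ℕ} [Fact p.Prime] (f : ℚ_[p] → ℂ) : Set (ℚ_[p] → ℂ) :=
  Set.range fun g : ℚ_[p]ˣ × ℚ_[p] => G g.1 g.2 f

/-- `f`, with wavelet expansion `f = ∑ C_i ψ_i`, is generic: its stabilizer is the intersection
of the stabilizers of the wavelets that contribute to the expansion. -/
def IsGeneric {p : ℕ} [Fact p.Prime] (f : ℚ_[p] → ℂ) (C : WaveletIndex p →₀ ℂ) : Prop :=
  f = waveletSum p C ∧ stabilizer f = ⋂ i ∈ C.support, stabilizer (wavelet p i)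

section Frames

variable {ι H : Type*} [NormedAddCommGroup H] [InnerProductSpace ℂ H]

/-- A family `u` in a Hilbert space is a frame. -/
def IsFrame (u : ι → H) : Prop :=
  ∃ A B : ℝ, 0 < A ∧ 0 < B ∧ ∀ g : H,
    Summable (fun i => ‖inner ℂ g (u i)‖ ^ 2) ∧
    A * ‖g‖ ^ 2 ≤ ∑' i, ‖inner ℂ g (u i)‖ ^ 2 ∧
    ∑' i, ‖inner ℂ g (u i)‖ ^ 2 ≤ B * ‖g‖ ^ 2

/-- A family `u` in a Hilbert space is a uniform tight frame: the two frame bounds can be taken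
equal, and all members have the same norm. -/
def IsUniformTightFrame (u : ι → H) : Prop :=
  (∃ A : ℝ, 0 < A ∧ ∀ g : H, HasSum (fun i => ‖inner ℂ g (u i)‖ ^ 2) (A * ‖g‖ ^ 2)) ∧
  ∀ i k, ‖u i‖ = ‖u k‖

end Frames

/-- A family of functions consists of square integrable functions, and is a frame
in `L²(ℚ_p)`. -/
def IsFrameL2 {p : ℕ} [Fact p.Prime] {ι : Type*} (u : ι → ℚ_[p] → ℂ) : Prop :=
  ∃ h : ∀ i, MemLp (u i) 2 (haar p), IsFrame fun i => (h i).toLp (u i)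

/-- A family of functions consists of square integrable functions, and is a uniform tight frame
in `L²(ℚ_p)`. -/
def IsUniformTightFrameL2 {p : ℕ} [Fact p.Prime] {ι : Type*} (u : ι → ℚ_[p] → ℂ) : Prop :=
  ∃ h : ∀ i, MemLp (u i) 2 (haar p), IsUniformTightFrame fun i => (h i).toLp (u i)

/-- The power `p^γ`, `γ ∈ ℤ`, as a nonzero element of `ℚ_p`. -/
def pPow (p : ℕ) [hp : Fact p.Prime] (γ : ℤ) : ℚ_[p]ˣ :=
  (Units.mk0 (p : ℚ_[p]) (Nat.cast_ne_zero.mpr hp.out.ne_zero)) ^ γ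

/-- The family `G(p^γ, p^γ n) φ`, with `γ ∈ ℤ`, `n ∈ ℚ_p / ℤ_p` and `φ` in the finite set `F`. -/
def waveletFamily {p : ℕ} [Fact p.Prime] (F : Finset (ℚ_[p] → ℂ)) :
    ℤ × FracReps p × F → ℚ_[p] → ℂ :=
  fun t => G (pPow p t.1) ((pPow p t.1 : ℚ_[p]) * ((t.2.1 : ℚ) : ℚ_[p])) t.2.2

/-- The family generated by the finite set `F` is a frame of `p`-adic wavelets: the members of `F`
are mean zero functions in `L²(ℚ_p)`, and the family is a frame in `L²(ℚ_p)`. -/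
def IsWaveletFrame {p : ℕ} [Fact p.Prime] (F : Finset (ℚ_[p] → ℂ)) : Prop :=
  (∀ φ ∈ F, MemLp φ 2 (haar p) ∧ Integrable φ (haar p) ∧ ∫ x, φ x ∂(haar p) = 0) ∧
  IsFrameL2 (waveletFamily F)

/-- The family `u` consists of exactly `N` copies of the set `S`, up to the order of its members. -/
def IsCopies {ι X : Type*} (N : ℕ) (u : ι → X) (S : Set X) : Prop :=
  ∃ e : ι ≃ S × Fin N, ∀ i, u i = (e i).1

end

end PadicWavelet

namespace PadicWavelet

noncomputable section

variable {p : ℕ} [hp : Fact p.Prime]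

/-! Let Γ be the affine group `Aff p`. It acts unitarily, and every wavelet is `wav g = g • mother
p` for some g in Γ. The subgroup P = `phaseGroup p` only multiplies the mother wavelet by a phase
χ(-b/p), so the lines spanned by wavelets are parametrized by Γ/P.

These lines form an orthonormal system: if g and h lie in different cosets of P, some s in Γ has
both `wav g` and `wav h` as eigenvectors with different eigenvalues (`exists_separating`), and
eigenvectors of a unitary map for different eigenvalues are orthogonal. The system is complete: if u
is orthogonal to all wavelets, the integral of its conjugate over a ball of radius p^k is p^k times
the integral over the concentric unit ball, whereas Cauchy-Schwarz allows only growth p^(k/2). This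
gives Parseval's identity over Γ/P (`hasSum_norm_inner_wavLp`).

After a dilation, f is a combination of pairwise non-proportional wavelets `wav (h i)` supported in
the unit ball. A congruence subgroup L of high level fixes all of them, so the frame sum can be
taken over Γ/L. Its diagonal terms are finite multiples of Parseval's identity. Its cross terms
vanish by the same separation: the separating s lies in K = `ballGroup p`, which normalizes L, so
right translation by s permutes Γ/L and multiplies the cross sum by a scalar different from 1
(`hasSum_coset_eq_zero`). The stabilizer S of the dilated f contains L and lies in K, so L has
finite index in S and tightness descends from Γ/L to Γ/S, which is the orbit
(`isUniformTightFrame_orbit`).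

The enumeration by (γ, n, φ) is a count of cosets of K. Let R be the dilation of norm p^r and let φ
range over the finite set R • K • w, where w is the dilated f. An element g • w then occurs once for
each (γ, n) such that g belongs to `gridAff γ n` * R * K. This fixes γ and confines n to a ball of
radius p^r, which contains p^r representatives (`exists_isCopies`). -/

theorem cast_p_ne_zero : (p : ℚ_[p]) ≠ 0 := Nat.cast_ne_zero.mpr hp.out.ne_zero

/-! ### The additive character -/

theorem exists_int_of_norm_div_le_one (z : ℤ) (k : ℕ) (h : ‖(z : ℚ_[p]) / (p : ℚ_[p]) ^ k‖ ≤ 1) :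
    ∃ d : ℤ, z = d * (p : ℤ) ^ k := by
  have hpk : (0 : ℝ) < (p : ℝ) ^ k := pow_pos (by exact_mod_cast hp.out.pos) k
  have h1 : ‖(z : ℚ_[p])‖ ≤ (p : ℝ) ^ (-(k : ℤ)) := by
    rw [norm_div, norm_pow, Padic.norm_p, inv_pow, div_inv_eq_mul] at h
    rw [zpow_neg, zpow_natCast, ← one_div, le_div_iff₀ hpk]
    exact h
  obtain ⟨d, hd⟩ := (Padic.norm_int_le_pow_iff_dvd z k).1 h1
  exact ⟨d, by rw [hd]; ring⟩

theorem norm_add_le_one {x y : ℚ_[p]} (hx : ‖x‖ ≤ 1) (hy : ‖y‖ ≤ 1) : ‖x + y‖ ≤ 1 :=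
  (IsUltrametricDist.norm_add_le_max x y).trans (max_le hx hy)

theorem norm_sub_le_one {x y : ℚ_[p]} (hx : ‖x‖ ≤ 1) (hy : ‖y‖ ≤ 1) : ‖x - y‖ ≤ 1 := by
  rw [sub_eq_add_neg]; exact norm_add_le_one hx (by rwa [norm_neg])

theorem exists_norm_sub_div_le_one (x : ℚ_[p]) :
    ∃ (z : ℤ) (k : ℕ), ‖x - (z : ℚ_[p]) / (p : ℚ_[p]) ^ k‖ ≤ 1 ∧
      fracPart p x = (z : ℚ) / (p : ℚ) ^ k := by
  obtain ⟨⟨k, m, -, hq⟩, h⟩ := (exists_fracRep p x).choose_spec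
  refine ⟨m, k, ?_, by rw [fracPart, hq]; push_cast; rfl⟩
  rw [hq] at h
  push_cast at h ⊢
  exact h

/-- Frees `chi` from the chosen representative: two fractions with p-power denominators
approximating x differ by a rational that is a p-adic integer, hence by an integer, which the
exponential does not see. -/
theorem chi_eq_exp {x : ℚ_[p]} {z : ℤ} {k : ℕ} (h : ‖x - (z : ℚ_[p]) / (p : ℚ_[p]) ^ k‖ ≤ 1) :
    chi p x = Complex.exp (2 * Real.pi * Complex.I * ((z : ℂ) / (p : ℂ) ^ k)) := by
  obtain ⟨m, l, h', hx⟩ := exists_norm_sub_div_le_one x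
  have hp0 := cast_p_ne_zero (p := p)
  have hd : ‖((m * p ^ k - z * p ^ l : ℤ) : ℚ_[p]) / (p : ℚ_[p]) ^ (k + l)‖ ≤ 1 := by
    convert norm_sub_le_one h h' using 2
    push_cast
    field_simp
    ring
  obtain ⟨d, hd⟩ := exists_int_of_norm_div_le_one _ _ hd
  have hpc : (p : ℂ) ≠ 0 := Nat.cast_ne_zero.mpr hp.out.ne_zero
  rw [chi, hx, Complex.exp_eq_exp_iff_exists_int]
  refine ⟨d, ?_⟩
  have hd' : (m : ℂ) * p ^ k - z * p ^ l = d * p ^ (k + l) := by exact_mod_cast hd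
  have : (m : ℂ) / p ^ l = z / p ^ k + d := by
    field_simp
    rw [pow_add] at hd'
    linear_combination hd'
  push_cast
  rw [this]
  ring

theorem chi_add (x y : ℚ_[p]) : chi p (x + y) = chi p x * chi p y := by
  obtain ⟨m, k, hx, -⟩ := exists_norm_sub_div_le_one x
  obtain ⟨n, l, hy, -⟩ := exists_norm_sub_div_le_one y
  have hp0 := cast_p_ne_zero (p := p)
  have hpc : (p : ℂ) ≠ 0 := Nat.cast_ne_zero.mpr hp.out.ne_zero
  have h : ‖x + y - ((m * p ^ l + n * p ^ k : ℤ) : ℚ_[p]) / (p : ℚ_[p]) ^ (k + l)‖ ≤ 1 := by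
    convert norm_add_le_one hx hy using 2
    push_cast
    field_simp
    ring
  rw [chi_eq_exp h, chi_eq_exp hx, chi_eq_exp hy, ← Complex.exp_add]
  congr 1
  push_cast
  field_simp
  ring

theorem chi_eq_one_iff {x : ℚ_[p]} : chi p x = 1 ↔ ‖x‖ ≤ 1 := by
  constructor
  · intro h
    obtain ⟨m, k, hx, -⟩ := exists_norm_sub_div_le_one x
    rw [chi_eq_exp hx, Complex.exp_eq_one_iff] at h
    obtain ⟨d, hd⟩ := h
    have hpc : (p : ℂ) ≠ 0 := Nat.cast_ne_zero.mpr hp.out.ne_zero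
    have h1 : (m : ℂ) = d * (p : ℂ) ^ k := by
      have h2 : (2 * Real.pi * Complex.I : ℂ) ≠ 0 := Complex.two_pi_I_ne_zero
      have h3 : (m : ℂ) / p ^ k = d := by
        apply mul_left_cancel₀ h2
        rw [hd]; ring
      field_simp at h3
      rw [h3, mul_comm]
    have h4 : m = d * (p : ℤ) ^ k := by exact_mod_cast h1
    have hp0 := cast_p_ne_zero (p := p)
    have h5 : (m : ℚ_[p]) / (p : ℚ_[p]) ^ k = (d : ℚ_[p]) := by
      rw [h4]; push_cast; field_simp
    have h6 := norm_add_le_one hx (Padic.norm_int_le_one (p := p) d)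
    rwa [h5, sub_add_cancel] at h6
  · intro h
    have : ‖x - ((0 : ℤ) : ℚ_[p]) / (p : ℚ_[p]) ^ 0‖ ≤ 1 := by simpa using h
    rw [chi_eq_exp this]
    simp

theorem norm_chi (x : ℚ_[p]) : ‖chi p x‖ = 1 := by
  have : chi p x = Complex.exp ((2 * Real.pi * (fracPart p x : ℝ) : ℝ) * Complex.I) := by
    rw [chi]; congr 1; push_cast; ring
  rw [this, Complex.norm_exp_ofReal_mul_I]

theorem chi_ne_zero (x : ℚ_[p]) : chi p x ≠ 0 := by
  rw [← norm_ne_zero_iff, norm_chi]; exact one_ne_zero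

theorem chi_zero : chi p (0 : ℚ_[p]) = 1 := chi_eq_one_iff.2 (by simp)

theorem chi_eq_chi_iff {x y : ℚ_[p]} : chi p x = chi p y ↔ ‖x - y‖ ≤ 1 := by
  have h : chi p x = chi p (x - y) * chi p y := by rw [← chi_add, sub_add_cancel]
  rw [← chi_eq_one_iff (x := x - y), h]
  simp [chi_ne_zero]

theorem chi_nsmul (n : ℕ) (x : ℚ_[p]) : chi p ((n : ℚ_[p]) * x) = chi p x ^ n := by
  induction n with
  | zero => simp [chi_zero]
  | succ n ih => rw [Nat.cast_succ, add_mul, one_mul, chi_add, ih, pow_succ]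

/-! ### The affine group and its action on functions -/

/-- The affine group of `ℚ_p`: the pair `(a, b)` stands for the map `x ↦ a x + b`. -/
@[ext]
structure Aff (p : ℕ) [Fact p.Prime] where
  /-- the linear part -/
  a : ℚ_[p]ˣ
  /-- the translation part -/
  b : ℚ_[p]

namespace Aff

instance : Mul (Aff p) := ⟨fun g h => ⟨g.a * h.a, g.b + g.a * h.b⟩⟩

instance : One (Aff p) := ⟨⟨1, 0⟩⟩

instance : Inv (Aff p) := ⟨fun g => ⟨g.a⁻¹, -((g.a⁻¹ : ℚ_[p]ˣ) : ℚ_[p]) * g.b⟩⟩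

@[simp] theorem mul_a (g h : Aff p) : (g * h).a = g.a * h.a := rfl

@[simp] theorem mul_b (g h : Aff p) : (g * h).b = g.b + g.a * h.b := rfl

@[simp] theorem one_a : (1 : Aff p).a = 1 := rfl

@[simp] theorem one_b : (1 : Aff p).b = 0 := rfl

@[simp] theorem inv_a (g : Aff p) : (g⁻¹).a = g.a⁻¹ := rfl

@[simp] theorem inv_b (g : Aff p) : (g⁻¹).b = -((g.a⁻¹ : ℚ_[p]ˣ) : ℚ_[p]) * g.b := rfl

instance : Group (Aff p) :=
  Group.ofLeftAxioms
    (fun g h k => by ext <;> simp [mul_assoc] ; ring)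
    (fun g => by ext <;> simp)
    (fun g => by ext <;> simp)

end Aff

theorem ofReal_norm_rpow_ne_zero (a : ℚ_[p]ˣ) :
    ((‖(a : ℚ_[p])‖ ^ (-(1 / 2) : ℝ) : ℝ) : ℂ) ≠ 0 := by
  have : 0 < ‖(a : ℚ_[p])‖ := norm_pos_iff.2 a.ne_zero
  exact_mod_cast (Real.rpow_pos_of_pos this _).ne'

instance instMulActionAff : MulAction (Aff p) (ℚ_[p] → ℂ) where
  smul g f := G g.a g.b f
  one_smul f := by
    funext x
    change G 1 0 f x = f x
    simp [G]
  mul_smul g h f := by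
    funext x
    change G (g.a * h.a) (g.b + g.a * h.b) f x = G g.a g.b (G h.a h.b f) x
    simp only [G, Units.val_mul, norm_mul]
    rw [Real.mul_rpow (norm_nonneg _) (norm_nonneg _)]
    have h1 : (x - (g.b + g.a * h.b)) / (g.a * h.a) = ((x - g.b) / g.a - h.b) / h.a := by
      have := g.a.ne_zero
      have := h.a.ne_zero
      field_simp
      ring
    rw [h1]
    push_cast
    ring

theorem smul_apply' (g : Aff p) (f : ℚ_[p] → ℂ) (x : ℚ_[p]) :
    (g • f) x = ((‖(g.a : ℚ_[p])‖ ^ (-(1 / 2) : ℝ) : ℝ) : ℂ) * f ((x - g.b) / (g.a : ℚ_[p])) := rfl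

theorem smul_const_mul (g : Aff p) (c : ℂ) (f : ℚ_[p] → ℂ) : g • (c • f) = c • (g • f) := by
  funext x
  simp only [smul_apply', Pi.smul_apply, smul_eq_mul]
  ring

theorem smul_sum {ι : Type*} (g : Aff p) (s : Finset ι) (f : ι → ℚ_[p] → ℂ) :
    g • (∑ i ∈ s, f i) = ∑ i ∈ s, g • f i := by
  funext x
  simp only [smul_apply', Finset.sum_apply, Finset.mul_sum]

theorem orbit_eq (f : ℚ_[p] → ℂ) : orbit f = MulAction.orbit (Aff p) f := by
  ext u
  constructor
  · rintro ⟨⟨a, b⟩, rfl⟩; exact ⟨⟨a, b⟩, rfl⟩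
  · rintro ⟨⟨a, b⟩, rfl⟩; exact ⟨⟨a, b⟩, rfl⟩

/-! ### Wavelets as the orbit of the mother wavelet -/

/-- The mother wavelet `χ(x/p) Ω(|x|_p)`. -/
def mother (p : ℕ) [Fact p.Prime] (x : ℚ_[p]) : ℂ :=
  if ‖x‖ ≤ 1 then chi p (x / p) else 0

theorem mother_of_le {x : ℚ_[p]} (h : ‖x‖ ≤ 1) : mother p x = chi p (x / p) := if_pos h

theorem mother_of_lt {x : ℚ_[p]} (h : ¬ ‖x‖ ≤ 1) : mother p x = 0 := if_neg h

/-- The image of the mother wavelet under an affine map. -/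
def wav (g : Aff p) : ℚ_[p] → ℂ := g • mother p

theorem smul_wav (g h : Aff p) : g • wav h = wav (g * h) := (mul_smul g h _).symm

/-- The affine map which takes the mother wavelet to the wavelet of index `(γ, n, j)`. -/
theorem exists_wavelet_eq_wav (i : WaveletIndex p) : ∃ g : Aff p, wavelet p i = wav g := by
  obtain ⟨γ, n, j, hj1, hj2⟩ := i
  have hp0 := cast_p_ne_zero (p := p)
  have hj0 : (j : ℚ_[p]) ≠ 0 := Nat.cast_ne_zero.mpr (by omega)
  have hpγ : (p : ℚ_[p]) ^ γ ≠ 0 := zpow_ne_zero _ hp0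
  have hjn : ‖(j : ℚ_[p])‖ = 1 := by
    rw [Padic.norm_natCast_eq_one_iff]
    exact Nat.coprime_of_lt_prime (by omega) hj2 hp.out
  have hn : ‖(p : ℚ_[p]) ^ (-γ) / (j : ℚ_[p])‖ = (p : ℝ) ^ γ := by
    rw [norm_div, hjn, div_one, Padic.norm_p_zpow, neg_neg]
  -- Since j is a unit, dividing the linear part by j changes neither the ball nor the
  -- normalization; it only puts j into the argument of χ.
  refine ⟨⟨Units.mk0 ((p : ℚ_[p]) ^ (-γ) / j) (div_ne_zero (zpow_ne_zero _ hp0) hj0),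
    (p : ℚ_[p]) ^ (-γ) * ((n : ℚ) : ℚ_[p])⟩, ?_⟩
  funext x
  have hx : (x - (p : ℚ_[p]) ^ (-γ) * ((n : ℚ) : ℚ_[p])) / ((p : ℚ_[p]) ^ (-γ) / j) =
      j * ((p : ℚ_[p]) ^ γ * x - ((n : ℚ) : ℚ_[p])) := by
    rw [zpow_neg]
    field_simp
  have hr : ((p : ℝ) ^ γ) ^ (-(1 / 2) : ℝ) = (p : ℝ) ^ (-(γ : ℝ) / 2) := by
    rw [← Real.rpow_intCast, ← Real.rpow_mul (Nat.cast_nonneg p)]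
    congr 1; ring
  rw [wav, smul_apply', Units.val_mk0, hx, hn, hr]
  have hm : ‖(j : ℚ_[p]) * ((p : ℚ_[p]) ^ γ * x - ((n : ℚ) : ℚ_[p]))‖ =
      ‖(p : ℚ_[p]) ^ γ * x - ((n : ℚ) : ℚ_[p])‖ := by rw [norm_mul, hjn, one_mul]
  rw [wavelet]
  by_cases h : ‖(p : ℚ_[p]) ^ γ * x - ((n : ℚ) : ℚ_[p])‖ ≤ 1
  · rw [if_pos h, mother_of_le (hm.trans_le h)]
    congr 2
    field_simp
  · rw [if_neg h, mother_of_lt (by rwa [hm]), mul_zero]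

theorem one_lt_p : (1 : ℝ) < p := by exact_mod_cast hp.out.one_lt

theorem norm_div_p_le_one_iff {x : ℚ_[p]} : ‖x / p‖ ≤ 1 ↔ ‖x‖ < 1 := by
  have h := Padic.norm_le_pow_iff_norm_lt_pow_add_one x (-1)
  have hp1 := one_lt_p (p := p)
  rw [norm_div, Padic.norm_p, div_inv_eq_mul, ← le_div_iff₀ (by linarith), one_div]
  simpa using h

theorem norm_eq_one_of_norm_sub_one_lt {x : ℚ_[p]} (h : ‖x - 1‖ < 1) : ‖x‖ = 1 := by
  have := IsUltrametricDist.norm_add_eq_max_of_norm_ne_norm (x := x - 1) (y := 1)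
    (by rw [norm_one]; exact h.ne)
  rwa [sub_add_cancel, norm_one, max_eq_right h.le] at this

/-- The affine maps which multiply the mother wavelet by a phase. -/
def phaseGroup (p : ℕ) [Fact p.Prime] : Subgroup (Aff p) where
  carrier := {g | ‖(g.a : ℚ_[p]) - 1‖ < 1 ∧ ‖g.b‖ ≤ 1}
  one_mem' := by simp
  mul_mem' := by
    rintro g h ⟨hg, hg'⟩ ⟨hh, hh'⟩
    have ha := norm_eq_one_of_norm_sub_one_lt hg
    constructor
    · have : ((g * h).a : ℚ_[p]) - 1 = g.a * (h.a - 1) + (g.a - 1) := by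
        rw [Aff.mul_a, Units.val_mul]; ring
      rw [this]
      refine (IsUltrametricDist.norm_add_le_max _ _).trans_lt (max_lt ?_ hg)
      rwa [norm_mul, ha, one_mul]
    · rw [Aff.mul_b]
      exact norm_add_le_one hg' (by rwa [norm_mul, ha, one_mul])
  inv_mem' := by
    rintro g ⟨hg, hg'⟩
    have ha := norm_eq_one_of_norm_sub_one_lt hg
    constructor
    · have : ((g⁻¹).a : ℚ_[p]) - 1 = -((g.a : ℚ_[p]) - 1) * (g.a : ℚ_[p])⁻¹ := by
        have := g.a.ne_zero
        rw [Aff.inv_a, Units.val_inv_eq_inv_val]; field_simp; ring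
      rw [this, norm_mul, norm_neg, norm_inv, ha, inv_one, mul_one]
      exact hg
    · rw [Aff.inv_b, norm_mul, norm_neg, Units.val_inv_eq_inv_val, norm_inv, ha, inv_one, one_mul]
      exact hg'

theorem mem_phaseGroup {g : Aff p} :
    g ∈ phaseGroup p ↔ ‖(g.a : ℚ_[p]) - 1‖ < 1 ∧ ‖g.b‖ ≤ 1 := Iff.rfl

/-- On the unit ball, a linear part congruent to 1 modulo p changes x/p by a p-adic integer only, so
just the translation part leaves a trace in χ. -/
theorem smul_mother_of_mem {g : Aff p} (hg : g ∈ phaseGroup p) :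
    g • mother p = chi p (-g.b / p) • mother p := by
  obtain ⟨h1, h2⟩ := hg
  have ha := norm_eq_one_of_norm_sub_one_lt h1
  have ha0 := g.a.ne_zero
  have hp0 := cast_p_ne_zero (p := p)
  funext x
  rw [smul_apply', ha, Pi.smul_apply, smul_eq_mul]
  have hn : ‖(x - g.b) / (g.a : ℚ_[p])‖ = ‖x - g.b‖ := by rw [norm_div, ha, div_one]
  by_cases hx : ‖x‖ ≤ 1
  · have hx' : ‖x - g.b‖ ≤ 1 := norm_sub_le_one hx h2
    rw [mother_of_le hx, mother_of_le (hn.trans_le hx'), ← chi_add]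
    simp only [Real.one_rpow, Complex.ofReal_one, one_mul]
    rw [chi_eq_chi_iff]
    have : (x - g.b) / (g.a : ℚ_[p]) / p - (-g.b / p + x / p) =
        -((g.a : ℚ_[p]) - 1) * ((x - g.b) / (g.a : ℚ_[p])) / p := by
      field_simp; ring
    rw [this, norm_div_p_le_one_iff, norm_mul, hn, norm_neg]
    exact mul_lt_one_of_nonneg_of_lt_one_left (norm_nonneg _) h1 hx'
  · have hx' : ¬ ‖x - g.b‖ ≤ 1 := fun h => hx (by simpa using norm_add_le_one h h2)
    rw [mother_of_lt hx, mother_of_lt (by rwa [hn]), mul_zero, mul_zero]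

theorem wav_mul_of_mem (h : Aff p) {g : Aff p} (hg : g ∈ phaseGroup p) :
    wav (h * g) = chi p (-g.b / p) • wav h := by
  rw [← smul_wav, wav, smul_mother_of_mem hg, smul_const_mul, wav]

theorem wav_apply_of_le {g : Aff p} {x : ℚ_[p]} (h : ‖x - g.b‖ ≤ ‖(g.a : ℚ_[p])‖) :
    wav g x = ((‖(g.a : ℚ_[p])‖ ^ (-(1 / 2) : ℝ) : ℝ) : ℂ) * chi p ((x - g.b) / g.a / p) := by
  rw [wav, smul_apply', mother_of_le]
  rw [norm_div]
  exact div_le_one_of_le₀ h (norm_nonneg _)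

theorem wav_apply_of_lt {g : Aff p} {x : ℚ_[p]} (h : ¬ ‖x - g.b‖ ≤ ‖(g.a : ℚ_[p])‖) :
    wav g x = 0 := by
  rw [wav, smul_apply', mother_of_lt, mul_zero]
  rwa [norm_div, div_le_one (norm_pos_iff.2 g.a.ne_zero)]

theorem isLocallyConstant_mother : IsLocallyConstant (mother p) := by
  rw [IsLocallyConstant.iff_eventually_eq]
  intro x
  filter_upwards [Metric.ball_mem_nhds x one_pos] with y hy
  rw [Metric.mem_ball, dist_eq_norm] at hy
  by_cases hx : ‖x‖ ≤ 1
  · have hy' : ‖y‖ ≤ 1 := by simpa using norm_add_le_one hy.le hx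
    rw [mother_of_le hx, mother_of_le hy', chi_eq_chi_iff, ← sub_div, norm_div_p_le_one_iff]
    exact hy
  · have hy' : ¬ ‖y‖ ≤ 1 := fun h => hx (by simpa using norm_sub_le_one h hy.le)
    rw [mother_of_lt hx, mother_of_lt hy']

theorem continuous_wav (g : Aff p) : Continuous (wav g) := by
  have : Continuous fun x : ℚ_[p] => (x - g.b) / (g.a : ℚ_[p]) := by fun_prop
  exact continuous_const.mul (isLocallyConstant_mother.continuous.comp this)

theorem hasCompactSupport_wav (g : Aff p) : HasCompactSupport (wav g) := by
  refine HasCompactSupport.intro (isCompact_closedBall g.b ‖(g.a : ℚ_[p])‖) fun x hx => ?_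
  rw [mem_closedBall_iff_norm] at hx
  exact wav_apply_of_lt hx

instance instIsAddHaarMeasureHaar : (haar p).IsAddHaarMeasure :=
  Measure.isAddHaarMeasure_addHaarMeasure _

theorem memLp_wav (g : Aff p) : MemLp (wav g) 2 (haar p) :=
  (continuous_wav g).memLp_of_hasCompactSupport (hasCompactSupport_wav g)

theorem integrable_wav (g : Aff p) : Integrable (wav g) (haar p) :=
  (continuous_wav g).integrable_of_hasCompactSupport (hasCompactSupport_wav g)

theorem chi_neg_inv_ne_one : chi p (-1 / p) ≠ 1 := by
  rw [Ne, chi_eq_one_iff, norm_div_p_le_one_iff]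
  simp

/-- Translation by `g.a` preserves the integral and multiplies `wav g` by χ(-1/p) ≠ 1. -/
theorem integral_wav (g : Aff p) : ∫ x, wav g x ∂(haar p) = 0 := by
  have hg : (⟨1, 1⟩ : Aff p) ∈ phaseGroup p := by simp [mem_phaseGroup]
  have h1 : (⟨1, g.a⟩ : Aff p) * g = g * ⟨1, 1⟩ := by
    ext <;> simp; ring
  have h2 : ∀ x, wav g (x - g.a) = chi p (-1 / p) * wav g x := by
    intro x
    have := congrFun (wav_mul_of_mem g hg) x
    rw [← h1, ← smul_wav, smul_apply'] at this
    simpa using this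
  have h3 := integral_sub_right_eq_self (μ := haar p) (wav g) (g.a : ℚ_[p])
  simp_rw [h2] at h3
  rw [integral_const_mul] at h3
  have h4 : (chi p (-1 / p) - 1) * ∫ x, wav g x ∂(haar p) = 0 := by rw [sub_mul, h3]; ring
  exact (mul_eq_zero.1 h4).resolve_left (sub_ne_zero.2 chi_neg_inv_ne_one)

theorem sum_chi_mul_div {y : ℚ_[p]} (hy : ‖y‖ ≤ 1) :
    ∑ j ∈ Finset.range p, chi p ((j : ℚ_[p]) * (y / p)) = if ‖y‖ < 1 then (p : ℂ) else 0 := by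
  simp_rw [chi_nsmul]
  split_ifs with h
  · rw [chi_eq_one_iff.2 (norm_div_p_le_one_iff.2 h)]; simp
  · have h1 : chi p (y / p) ≠ 1 := by rwa [Ne, chi_eq_one_iff, norm_div_p_le_one_iff]
    rw [geom_sum_eq h1, ← chi_nsmul, mul_div_cancel₀ _ cast_p_ne_zero, chi_eq_one_iff.2 hy]
    simp

theorem norm_natCast_eq_one {j : ℕ} (h0 : 1 ≤ j) (h1 : j < p) : ‖(j : ℚ_[p])‖ = 1 := by
  rw [Padic.norm_natCast_eq_one_iff]
  exact Nat.coprime_of_lt_prime (by omega) h1 hp.out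

/-! ### Integrals over balls and scaling of Haar measure -/

/-- The indicator of a ball of radius `|p a|` is a combination of the indicator of the ball of
radius `|a|` with the same center and of wavelets. -/
theorem exists_indicator_eq_add_sum_wav (a : ℚ_[p]ˣ) (b : ℚ_[p]) :
    ∃ (c : ℂ) (g : ℕ → Aff p), ∀ x,
      (p : ℂ) * (Metric.closedBall b ‖(p : ℚ_[p]) * a‖).indicator 1 x =
        (Metric.closedBall b ‖(a : ℚ_[p])‖).indicator 1 x +
          ∑ j ∈ Finset.Ico 1 p, c * wav (g j) x := by
  classical
  have hp0 := cast_p_ne_zero (p := p)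
  have ha0 := a.ne_zero
  have hna : 0 < ‖(a : ℚ_[p])‖ := norm_pos_iff.2 ha0
  refine ⟨((‖(a : ℚ_[p])‖ ^ (-(1 / 2) : ℝ) : ℝ) : ℂ)⁻¹, fun j =>
    ⟨if h : (j : ℚ_[p]) = 0 then 1 else a * (Units.mk0 (j : ℚ_[p]) h)⁻¹, b⟩, fun x => ?_⟩
  have key : ∀ j ∈ Finset.Ico 1 p,
      (((‖(a : ℚ_[p])‖ ^ (-(1 / 2) : ℝ) : ℝ) : ℂ)⁻¹ * wav
        ⟨if h : (j : ℚ_[p]) = 0 then 1 else a * (Units.mk0 (j : ℚ_[p]) h)⁻¹, b⟩ x : ℂ) =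
      if ‖x - b‖ ≤ ‖(a : ℚ_[p])‖ then chi p ((j : ℚ_[p]) * ((x - b) / a / p)) else 0 := by
    intro j hj
    rw [Finset.mem_Ico] at hj
    have hj0 : (j : ℚ_[p]) ≠ 0 := Nat.cast_ne_zero.mpr (by omega)
    have hn : ‖((a * (Units.mk0 (j : ℚ_[p]) hj0)⁻¹ : ℚ_[p]ˣ) : ℚ_[p])‖ = ‖(a : ℚ_[p])‖ := by
      rw [Units.val_mul, Units.val_inv_eq_inv_val, Units.val_mk0, norm_mul, norm_inv,
        norm_natCast_eq_one hj.1 hj.2, inv_one, mul_one]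
    rw [dif_neg hj0]
    by_cases h : ‖x - b‖ ≤ ‖(a : ℚ_[p])‖
    · rw [if_pos h, wav_apply_of_le (by rw [hn]; exact h), hn,
        inv_mul_cancel_left₀ (ofReal_norm_rpow_ne_zero a)]
      congr 1
      rw [Units.val_mul, Units.val_inv_eq_inv_val, Units.val_mk0]
      field_simp
    · rw [if_neg h, wav_apply_of_lt (by rw [hn]; exact h), mul_zero]
  rw [Finset.sum_congr rfl key]
  have hpa : ‖(p : ℚ_[p]) * a‖ ≤ ‖(a : ℚ_[p])‖ := by
    rw [norm_mul, Padic.norm_p]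
    exact mul_le_of_le_one_left hna.le (inv_le_one_of_one_le₀ one_lt_p.le)
  by_cases h : ‖x - b‖ ≤ ‖(a : ℚ_[p])‖
  · have hy : ‖(x - b) / (a : ℚ_[p])‖ ≤ 1 := by
      rw [norm_div]; exact div_le_one_of_le₀ h hna.le
    have hs := sum_chi_mul_div hy
    rw [Finset.range_eq_Ico, Finset.sum_eq_sum_Ico_succ_bot hp.out.pos] at hs
    simp only [if_pos h]
    rw [Set.indicator_of_mem (s := Metric.closedBall b ‖(a : ℚ_[p])‖) (mem_closedBall_iff_norm.2 h)]
    rw [Nat.cast_zero, zero_mul, chi_zero] at hs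
    rw [Pi.one_apply, hs]
    have hiff : ‖(x - b) / (a : ℚ_[p])‖ < 1 ↔ x ∈ Metric.closedBall b ‖(p : ℚ_[p]) * a‖ := by
      rw [← norm_div_p_le_one_iff, mem_closedBall_iff_norm, div_div, norm_div,
        div_le_one (norm_pos_iff.2 (mul_ne_zero ha0 hp0)), mul_comm]
    split_ifs with h'
    · rw [Set.indicator_of_mem (hiff.1 h')]; simp
    · rw [Set.indicator_of_notMem (fun h'' => h' (hiff.2 h''))]; simp
  · simp only [if_neg h]
    rw [Set.indicator_of_notMem (fun h' => h (mem_closedBall_iff_norm.1 h')),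
      Set.indicator_of_notMem (fun h' => h ((mem_closedBall_iff_norm.1 h').trans hpa))]
    simp

/-- A locally integrable function which is orthogonal to all wavelets has the same mean on a ball
and on the concentric balls of the previous radius. -/
theorem mul_setIntegral_closedBall {F : ℚ_[p] → ℂ} (hF : LocallyIntegrable F (haar p))
    (h0 : ∀ g : Aff p, ∫ x, F x * wav g x ∂(haar p) = 0) (a : ℚ_[p]ˣ) (b : ℚ_[p]) :
    (p : ℂ) * ∫ x in Metric.closedBall b ‖(p : ℚ_[p]) * a‖, F x ∂(haar p) =
      ∫ x in Metric.closedBall b ‖(a : ℚ_[p])‖, F x ∂(haar p) := by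
  obtain ⟨c, g, h⟩ := exists_indicator_eq_add_sum_wav a b
  have hmeas : ∀ r, MeasurableSet (Metric.closedBall b r) := fun r =>
    Metric.isClosed_closedBall.measurableSet
  have hind : ∀ r x, (Metric.closedBall b r).indicator F x =
      F x * (Metric.closedBall b r).indicator 1 x := by
    intro r x
    by_cases hx : x ∈ Metric.closedBall b r
    · simp [Set.indicator_of_mem hx]
    · simp [Set.indicator_of_notMem hx]
  have hint : ∀ g : Aff p, Integrable (fun x => F x * wav g x) (haar p) := by
    intro g
    have := hF.integrable_smul_left_of_hasCompactSupport (continuous_wav g)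
      (hasCompactSupport_wav g)
    simpa [mul_comm] using this
  have hball : Integrable ((Metric.closedBall b ‖(a : ℚ_[p])‖).indicator F) (haar p) :=
    (integrable_indicator_iff (hmeas _)).2
      (hF.integrableOn_isCompact (isCompact_closedBall _ _))
  rw [← integral_indicator (hmeas _), ← integral_indicator (hmeas _), ← integral_const_mul]
  have : ∀ x, (p : ℂ) * (Metric.closedBall b ‖(p : ℚ_[p]) * a‖).indicator F x =
      (Metric.closedBall b ‖(a : ℚ_[p])‖).indicator F x +
        ∑ j ∈ Finset.Ico 1 p, c * (F x * wav (g j) x) := by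
    intro x
    rw [hind, hind, mul_left_comm, h x, mul_add, Finset.mul_sum]
    congr 1
    exact Finset.sum_congr rfl fun j _ => by ring
  simp_rw [this]
  rw [integral_add hball (integrable_finsetSum _ fun j _ => (hint _).const_mul c),
    integral_finsetSum _ fun j _ => (hint _).const_mul c]
  simp [integral_const_mul, h0]

theorem setIntegral_closedBall_zpow {F : ℚ_[p] → ℂ} (hF : LocallyIntegrable F (haar p))
    (h0 : ∀ g : Aff p, ∫ x, F x * wav g x ∂(haar p) = 0) (b : ℚ_[p]) (k : ℤ) :
    ∫ x in Metric.closedBall b ((p : ℝ) ^ k), F x ∂(haar p) =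
      (p : ℂ) ^ k * ∫ x in Metric.closedBall b 1, F x ∂(haar p) := by
  have hpc : (p : ℂ) ≠ 0 := Nat.cast_ne_zero.mpr hp.out.ne_zero
  have hpr : (p : ℝ) ≠ 0 := Nat.cast_ne_zero.mpr hp.out.ne_zero
  have step : ∀ m : ℤ, (p : ℂ) * ∫ x in Metric.closedBall b ((p : ℝ) ^ m), F x ∂(haar p) =
      ∫ x in Metric.closedBall b ((p : ℝ) ^ (m + 1)), F x ∂(haar p) := by
    intro m
    have := mul_setIntegral_closedBall hF h0 (Units.mk0 ((p : ℚ_[p]) ^ (-(m + 1)))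
      (zpow_ne_zero _ cast_p_ne_zero)) b
    rw [Units.val_mk0, norm_mul, Padic.norm_p_zpow, Padic.norm_p, neg_neg] at this
    rwa [zpow_add_one₀ hpr, mul_comm ((p : ℝ) ^ m), inv_mul_cancel_left₀ hpr,
      mul_comm (p : ℝ), ← zpow_add_one₀ hpr] at this
  induction k using Int.induction_on with
  | zero => simp
  | succ k ih => rw [← step, ih, zpow_add_one₀ hpc]; ring
  | pred k ih =>
    have := step (-(k : ℤ) - 1)
    rw [sub_add_cancel, ih] at this
    rw [zpow_sub_one₀ hpc, mul_right_comm, ← this]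
    field_simp

theorem haar_closedBall_one (b : ℚ_[p]) : haar p (Metric.closedBall b 1) = 1 := by
  have h := Measure.addHaarMeasure_self (K₀ := unitBall p)
  have h1 : haar p (Metric.closedBall 0 1) = 1 := h
  rw [← h1]
  have := measure_preimage_add_right (haar p) (-b) (Metric.closedBall (0 : ℚ_[p]) 1)
  rw [← this]
  congr 1
  ext x
  simp [dist_eq_norm, sub_eq_add_neg]

/-- The constant 1 is orthogonal to every wavelet, wavelets having mean zero, so the scaling of ball
integrals applies to it. -/
theorem haar_real_closedBall_zpow (b : ℚ_[p]) (k : ℤ) :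
    (haar p).real (Metric.closedBall b ((p : ℝ) ^ k)) = (p : ℝ) ^ k := by
  have h := setIntegral_closedBall_zpow (p := p) (F := fun _ => 1) (locallyIntegrable_const 1)
    (fun g => by simpa using integral_wav g) b k
  simp only [setIntegral_const, Measure.real, haar_closedBall_one] at h
  simp only [ENNReal.toReal_one, one_smul, mul_one, Complex.real_smul] at h
  have h' : (((haar p (Metric.closedBall b ((p : ℝ) ^ k))).toReal : ℝ) : ℂ) =
      (((p : ℝ) ^ k : ℝ) : ℂ) := by
    rw [h]; push_cast; rfl
  exact Complex.ofReal_injective h'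

theorem haar_closedBall_norm (a : ℚ_[p]ˣ) :
    haar p (Metric.closedBall 0 ‖(a : ℚ_[p])‖) = ENNReal.ofReal ‖(a : ℚ_[p])‖ := by
  have hk' := Padic.norm_eq_zpow_neg_valuation a.ne_zero
  have h := haar_real_closedBall_zpow (p := p) 0 (-(a : ℚ_[p]).valuation)
  rw [hk']
  nth_rw 2 [← h]
  rw [Measure.real, ENNReal.ofReal_toReal]
  exact ((isCompact_closedBall (0 : ℚ_[p]) _).measure_lt_top (μ := haar p)).ne

/-- The image measure is again a Haar measure, so by uniqueness only the volume of the preimage of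
the unit ball matters. -/
theorem map_mul_haar (a : ℚ_[p]ˣ) :
    (haar p).map (fun x => x / (a : ℚ_[p])) = ENNReal.ofReal ‖(a : ℚ_[p])‖ • haar p := by
  have hcont : Continuous fun x : ℚ_[p] => x / (a : ℚ_[p]) := by fun_prop
  let e : ℚ_[p] ≃ₜ ℚ_[p] := Homeomorph.mulRight₀ ((a : ℚ_[p])⁻¹) (inv_ne_zero a.ne_zero)
  have he : (⇑(AddMonoidHom.mulRight ((a : ℚ_[p])⁻¹))) = fun x => x / (a : ℚ_[p]) := by
    funext x; simp [div_eq_mul_inv]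
  have hH := Measure.isAddHaarMeasure_map (haar p) (AddMonoidHom.mulRight ((a : ℚ_[p])⁻¹))
    (he ▸ hcont) e.surjective e.isClosedEmbedding.tendsto_cocompact
  rw [he] at hH
  have := Measure.addHaarMeasure_unique ((haar p).map fun x => x / (a : ℚ_[p])) (unitBall p)
  rw [this]
  change _ • haar p = _
  congr 1
  rw [Measure.map_apply hcont.measurable (unitBall p).isCompact.isClosed.measurableSet,
    ← haar_closedBall_norm]
  congr 1
  ext x
  change x / (a : ℚ_[p]) ∈ Metric.closedBall 0 1 ↔ _
  rw [mem_closedBall_zero_iff, mem_closedBall_zero_iff, norm_div,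
    div_le_one (norm_pos_iff.2 a.ne_zero)]

theorem integral_comp_sub_div (f : ℚ_[p] → ℂ) (a : ℚ_[p]ˣ) (b : ℚ_[p]) :
    ∫ x, f ((x - b) / a) ∂(haar p) = (‖(a : ℚ_[p])‖ : ℂ) * ∫ x, f x ∂(haar p) := by
  rw [integral_sub_right_eq_self (μ := haar p) (fun x => f (x / a)) b]
  let e : ℚ_[p] ≃ₜ ℚ_[p] := Homeomorph.mulRight₀ ((a : ℚ_[p])⁻¹) (inv_ne_zero a.ne_zero)
  have h := e.measurableEmbedding.integral_map (μ := haar p) f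
  have he : (⇑e) = fun x => x / (a : ℚ_[p]) := by funext x; simp [e, div_eq_mul_inv]
  rw [he, map_mul_haar, integral_smul_measure] at h
  rw [← h, ENNReal.toReal_ofReal (norm_nonneg _)]
  simp

/-! ### Orthonormality by separating eigenvalues -/

/-- The Hilbert space `L²(ℚ_p)`. -/
abbrev L2 (p : ℕ) [Fact p.Prime] : Type := Lp ℂ 2 (haar p)

/-- A wavelet as an element of `L²(ℚ_p)`. -/
def wavLp (g : Aff p) : L2 p := (memLp_wav g).toLp (wav g)

theorem inner_wavLp (g h : Aff p) :
    inner ℂ (wavLp g) (wavLp h) = ∫ x, wav h x * starRingEnd ℂ (wav g x) ∂(haar p) := by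
  rw [L2.inner_def]
  refine integral_congr_ae ?_
  filter_upwards [(memLp_wav g).coeFn_toLp, (memLp_wav h).coeFn_toLp] with x h1 h2
  rw [wavLp, wavLp, h1, h2, RCLike.inner_apply]

theorem inner_wavLp_right (u : L2 p) (g : Aff p) :
    inner ℂ u (wavLp g) = ∫ x, starRingEnd ℂ (u x) * wav g x ∂(haar p) := by
  rw [L2.inner_def]
  refine integral_congr_ae ?_
  filter_upwards [(memLp_wav g).coeFn_toLp] with x h1
  rw [wavLp, h1, RCLike.inner_apply, mul_comm]

/-- Unitarity of the action: the two normalizing factors multiply to |a|⁻¹, which cancels the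
Jacobian. -/
theorem inner_wavLp_mul (k g h : Aff p) :
    inner ℂ (wavLp (k * g)) (wavLp (k * h)) = inner ℂ (wavLp g) (wavLp h) := by
  rw [inner_wavLp, inner_wavLp, ← smul_wav, ← smul_wav]
  have h0 : 0 < ‖(k.a : ℚ_[p])‖ := norm_pos_iff.2 k.a.ne_zero
  have hr : ‖(k.a : ℚ_[p])‖ ^ (-(1 / 2) : ℝ) * ‖(k.a : ℚ_[p])‖ ^ (-(1 / 2) : ℝ) =
      ‖(k.a : ℚ_[p])‖⁻¹ := by
    rw [← Real.rpow_add h0, ← Real.rpow_neg_one]; norm_num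
  have : ∀ x, (k • wav h) x * starRingEnd ℂ ((k • wav g) x) =
      ((‖(k.a : ℚ_[p])‖⁻¹ : ℝ) : ℂ) *
        (fun y => wav h y * starRingEnd ℂ (wav g y)) ((x - k.b) / k.a) := by
    intro x
    rw [smul_apply', smul_apply', ← hr, map_mul, Complex.conj_ofReal]
    push_cast
    ring
  simp_rw [this]
  rw [integral_const_mul,
    integral_comp_sub_div (fun y => wav h y * starRingEnd ℂ (wav g y)) k.a k.b, ← mul_assoc,
    ← Complex.ofReal_mul, inv_mul_cancel₀ h0.ne', Complex.ofReal_one, one_mul]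

theorem wavLp_mul_of_mem (h : Aff p) {g : Aff p} (hg : g ∈ phaseGroup p) :
    wavLp (h * g) = chi p (-g.b / p) • wavLp h := by
  rw [wavLp, wavLp, ← MemLp.toLp_const_smul]
  exact MemLp.toLp_congr _ _ (by rw [wav_mul_of_mem h hg])

theorem norm_wavLp (g : Aff p) : ‖wavLp g‖ = 1 := by
  have h1 : inner ℂ (wavLp g) (wavLp g) = (1 : ℂ) := by
    have h := inner_wavLp_mul g 1 1
    rw [mul_one] at h
    rw [h, inner_wavLp]
    have : ∀ x : ℚ_[p], wav 1 x * starRingEnd ℂ (wav 1 x) =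
        (Metric.closedBall (0 : ℚ_[p]) 1).indicator (fun _ => (1 : ℂ)) x := by
      intro x
      rw [wav, one_smul]
      by_cases hx : ‖x‖ ≤ 1
      · rw [mother_of_le hx, Set.indicator_of_mem (mem_closedBall_zero_iff.2 hx), Complex.mul_conj,
          Complex.normSq_eq_norm_sq, norm_chi]
        simp
      · rw [mother_of_lt hx, Set.indicator_of_notMem (fun h => hx (mem_closedBall_zero_iff.1 h)),
          zero_mul]
    simp_rw [this]
    rw [integral_indicator Metric.isClosed_closedBall.measurableSet, setIntegral_const,
      Measure.real, haar_closedBall_one]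
    simp
  have h2 : ‖wavLp g‖ ^ 2 = 1 := by rw [norm_sq_eq_re_inner (𝕜 := ℂ), h1]; simp
  exact (pow_eq_one_iff_of_nonneg (norm_nonneg _) two_ne_zero).1 h2

/-- The subgroup of the affine maps which preserve the unit ball. -/
def ballGroup (p : ℕ) [Fact p.Prime] : Subgroup (Aff p) where
  carrier := {g | ‖(g.a : ℚ_[p])‖ = 1 ∧ ‖g.b‖ ≤ 1}
  one_mem' := by simp
  mul_mem' := by
    rintro g h ⟨hg, hg'⟩ ⟨hh, hh'⟩
    constructor
    · rw [Aff.mul_a, Units.val_mul, norm_mul, hg, hh, one_mul]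
    · rw [Aff.mul_b]
      exact norm_add_le_one hg' (by rwa [norm_mul, hg, one_mul])
  inv_mem' := by
    rintro g ⟨hg, hg'⟩
    constructor
    · rw [Aff.inv_a, Units.val_inv_eq_inv_val, norm_inv, hg, inv_one]
    · rw [Aff.inv_b, norm_mul, norm_neg, Units.val_inv_eq_inv_val, norm_inv, hg, inv_one, one_mul]
      exact hg'

theorem mem_ballGroup {g : Aff p} : g ∈ ballGroup p ↔ ‖(g.a : ℚ_[p])‖ = 1 ∧ ‖g.b‖ ≤ 1 := Iff.rfl

/-- If the linear parts differ to first order, translation by `g.a` separates: it acts on the two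
wavelets with translation parts 1 and `g.a / h.a`. Otherwise being in different cosets forces the
centers to be farther apart than the common radius, and a dilation about `g.b` separates. The bounds
on s serve to place it in `ballGroup p`. -/
theorem exists_separating_of_le {g h : Aff p} (hgh : g⁻¹ * h ∉ phaseGroup p)
    (hle : ‖(g.a : ℚ_[p])‖ ≤ ‖(h.a : ℚ_[p])‖) :
    ∃ s u v : Aff p, u ∈ phaseGroup p ∧ v ∈ phaseGroup p ∧ s * g = g * u ∧ s * h = h * v ∧
      1 ≤ ‖u.b - v.b‖ ∧ ‖(s.a : ℚ_[p])‖ = 1 ∧ ‖s.b‖ ≤ max ‖(g.a : ℚ_[p])‖ ‖g.b‖ := by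
  have ga0 := g.a.ne_zero
  have ha0 := h.a.ne_zero
  have hg : 0 < ‖(g.a : ℚ_[p])‖ := norm_pos_iff.2 ga0
  have hh : 0 < ‖(h.a : ℚ_[p])‖ := norm_pos_iff.2 ha0
  by_cases hsep : ‖1 - (g.a : ℚ_[p]) / h.a‖ < 1
  · have hq : ‖(g.a : ℚ_[p]) / h.a‖ = 1 :=
      norm_eq_one_of_norm_sub_one_lt (by rwa [← norm_neg, neg_sub])
    have hnorm : ‖(g.a : ℚ_[p])‖ = ‖(h.a : ℚ_[p])‖ := by
      rwa [norm_div, div_eq_one_iff_eq hh.ne'] at hq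
    have hb : ‖(g.a : ℚ_[p])‖ < ‖g.b - h.b‖ := by
      by_contra hb
      apply hgh
      rw [mem_phaseGroup]
      constructor
      · have : (((g⁻¹ * h).a : ℚ_[p]ˣ) : ℚ_[p]) - 1 =
            (1 - (g.a : ℚ_[p]) / h.a) * ((h.a : ℚ_[p]) / g.a) := by
          rw [Aff.mul_a, Aff.inv_a, Units.val_mul, Units.val_inv_eq_inv_val]
          field_simp
        rw [this, norm_mul, norm_div (h.a : ℚ_[p]), hnorm, div_self hh.ne', mul_one]
        exact hsep
      · have : (g⁻¹ * h).b = -((g.b - h.b) / g.a) := by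
          rw [Aff.mul_b, Aff.inv_b, Aff.inv_a, Units.val_inv_eq_inv_val]
          field_simp
          ring
        rw [this, norm_neg, norm_div, div_le_one hg]
        exact not_lt.1 hb
    have hb0 : g.b - h.b ≠ 0 := norm_pos_iff.1 (hg.trans hb)
    -- The dilation by 1 + t about `g.b` moves `h.b` by exactly `-g.a`; this choice of t makes u
    -- trivial on translations and gives v the translation part `-g.a / h.a`, of norm 1.
    set t : ℚ_[p] := g.a / (g.b - h.b) with ht
    have htn : ‖t‖ < 1 := by rw [ht, norm_div, div_lt_one (norm_pos_iff.2 hb0)]; exact hb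
    have ht1 : ‖1 + t‖ = 1 := norm_eq_one_of_norm_sub_one_lt (by rwa [add_sub_cancel_left])
    have ht0 : 1 + t ≠ 0 := norm_pos_iff.1 (by rw [ht1]; exact one_pos)
    refine ⟨⟨Units.mk0 (1 + t) ht0, -t * g.b⟩, ⟨Units.mk0 (1 + t) ht0, 0⟩,
      ⟨Units.mk0 (1 + t) ht0, -((g.a : ℚ_[p]) / h.a)⟩, ?_, ?_, ?_, ?_, ?_, ht1, ?_⟩
    · simp [mem_phaseGroup, htn]
    · rw [mem_phaseGroup, norm_neg, hq, Units.val_mk0, add_sub_cancel_left]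
      exact ⟨htn, le_rfl⟩
    · ext
      · simp [mul_comm]
      · simp; ring
    · ext
      · simp [mul_comm]
      · simp only [Aff.mul_b, Units.val_mk0]
        rw [ht]
        field_simp
        ring
    · simp only [zero_sub, neg_neg]
      exact hq.ge
    · rw [norm_mul, norm_neg]
      exact (mul_le_of_le_one_left (norm_nonneg _) htn.le).trans (le_max_right _ _)
  · refine ⟨⟨1, g.a⟩, ⟨1, 1⟩, ⟨1, (g.a : ℚ_[p]) / h.a⟩, by simp [mem_phaseGroup], ?_, ?_, ?_,
      not_lt.1 hsep, by simp, le_max_left _ _⟩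
    · rw [mem_phaseGroup, norm_div, div_le_one hh]
      simpa using hle
    · ext <;> simp; ring
    · ext
      · simp
      · simp only [Aff.mul_b, Units.val_one, one_mul]
        field_simp
        ring

/-- Two wavelets which are not proportional are eigenvectors, with different eigenvalues, of some
element of the affine group. -/
theorem exists_separating {g h : Aff p} (hgh : g⁻¹ * h ∉ phaseGroup p) :
    ∃ s u v : Aff p, u ∈ phaseGroup p ∧ v ∈ phaseGroup p ∧ s * g = g * u ∧ s * h = h * v ∧
      chi p (-u.b / p) ≠ chi p (-v.b / p) ∧
      (‖(g.a : ℚ_[p])‖ ≤ 1 → ‖g.b‖ ≤ 1 → ‖(h.a : ℚ_[p])‖ ≤ 1 → ‖h.b‖ ≤ 1 →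
        s ∈ ballGroup p) := by
  have key : ∀ u v : ℚ_[p], 1 ≤ ‖u - v‖ → chi p (-u / p) ≠ chi p (-v / p) := by
    intro u v huv
    have h : -(-u - -v) = u - v := by ring
    rwa [Ne, chi_eq_chi_iff, ← sub_div, norm_div_p_le_one_iff, not_lt, ← norm_neg, h]
  rcases le_total ‖(g.a : ℚ_[p])‖ ‖(h.a : ℚ_[p])‖ with hle | hle
  · obtain ⟨s, u, v, hu, hv, h1, h2, h3, h4, h5⟩ := exists_separating_of_le hgh hle
    exact ⟨s, u, v, hu, hv, h1, h2, key _ _ h3, fun a b _ _ => ⟨h4, h5.trans (max_le a b)⟩⟩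
  · have hhg : h⁻¹ * g ∉ phaseGroup p := fun h' => hgh (by
      have := (phaseGroup p).inv_mem h'
      rwa [mul_inv_rev, inv_inv] at this)
    obtain ⟨s, u, v, hu, hv, h1, h2, h3, h4, h5⟩ := exists_separating_of_le hhg hle
    exact ⟨s, v, u, hv, hu, h2, h1, (key _ _ h3).symm, fun _ _ a b => ⟨h4, h5.trans (max_le a b)⟩⟩

theorem conj_chi_mul_chi (x : ℚ_[p]) : chi p x * starRingEnd ℂ (chi p x) = 1 := by
  rw [Complex.mul_conj, Complex.normSq_eq_norm_sq, norm_chi]; simp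

theorem conj_chi_mul_ne_one {x y : ℚ_[p]} (h : chi p x ≠ chi p y) :
    starRingEnd ℂ (chi p x) * chi p y ≠ 1 := by
  intro h'
  apply h
  have := congrArg (chi p x * ·) h'
  simp only [mul_one] at this
  rw [← mul_assoc, conj_chi_mul_chi, one_mul] at this
  exact this.symm

/-- The unitary map s multiplies the inner product by the conjugate of one eigenvalue times the
other; as these are distinct and of modulus 1, the factor is not 1. -/
theorem inner_wavLp_eq_zero {g h : Aff p} (hgh : g⁻¹ * h ∉ phaseGroup p) :
    inner ℂ (wavLp g) (wavLp h) = (0 : ℂ) := by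
  obtain ⟨s, u, v, hu, hv, h1, h2, h3, -⟩ := exists_separating hgh
  have h4 := inner_wavLp_mul s g h
  rw [h1, h2, wavLp_mul_of_mem g hu, wavLp_mul_of_mem h hv, inner_smul_left, inner_smul_right,
    ← mul_assoc] at h4
  have h5 : (starRingEnd ℂ (chi p (-u.b / p)) * chi p (-v.b / p) - 1) *
      inner ℂ (wavLp g) (wavLp h) = 0 := by rw [sub_mul, h4, one_mul, sub_self]
  exact (mul_eq_zero.1 h5).resolve_left (sub_ne_zero.2 (conj_chi_mul_ne_one h3))

theorem p_zpow_pos (k : ℤ) : (0 : ℝ) < (p : ℝ) ^ k := zpow_pos (by exact_mod_cast hp.out.pos) k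

/-! ### Completeness and Parseval's identity -/

theorem isTopologicalBasis_closedBall_zpow :
    TopologicalSpace.IsTopologicalBasis
      (Set.range fun t : ℚ_[p] × ℤ => Metric.closedBall t.1 ((p : ℝ) ^ t.2)) := by
  refine TopologicalSpace.isTopologicalBasis_of_isOpen_of_nhds ?_ ?_
  · rintro _ ⟨⟨b, k⟩, rfl⟩
    exact IsUltrametricDist.isOpen_closedBall _ (p_zpow_pos k).ne'
  · intro b U hb hU
    obtain ⟨ε, hε, hεU⟩ := Metric.isOpen_iff.1 hU b hb
    obtain ⟨n, hn⟩ := exists_pow_lt_of_lt_one hε (inv_lt_one_of_one_lt₀ (one_lt_p (p := p)))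
    refine ⟨_, ⟨(b, -(n : ℤ)), rfl⟩, Metric.mem_closedBall_self (p_zpow_pos _).le, ?_⟩
    refine (Metric.closedBall_subset_ball ?_).trans hεU
    rw [zpow_neg, zpow_natCast, ← inv_pow]
    exact hn

theorem isPiSystem_closedBall_zpow :
    IsPiSystem (Set.range fun t : ℚ_[p] × ℤ => Metric.closedBall t.1 ((p : ℝ) ^ t.2)) := by
  rintro _ ⟨⟨b, k⟩, rfl⟩ _ ⟨⟨c, l⟩, rfl⟩ hne
  rcases IsUltrametricDist.closedBall_subset_trichotomy b c ((p : ℝ) ^ k) ((p : ℝ) ^ l)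
    with h | h | h
  · exact ⟨(b, k), (Set.inter_eq_left.2 h).symm⟩
  · exact ⟨(c, l), (Set.inter_eq_right.2 h).symm⟩
  · exact absurd (Set.disjoint_iff_inter_eq_empty.1 h) hne.ne_empty

/-- Inside a large ball F is integrable, and the sets over which it integrates to zero there form a
λ-system. Ultrametric balls are nested or disjoint, hence a π-system, and they generate the Borel
sets. -/
theorem ae_eq_zero_of_setIntegral_closedBall {F : ℚ_[p] → ℂ} (hF : LocallyIntegrable F (haar p))
    (h0 : ∀ b (k : ℤ), ∫ x in Metric.closedBall b ((p : ℝ) ^ k), F x ∂(haar p) = 0) :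
    F =ᵐ[haar p] 0 := by
  have hball : ∀ R : ℕ, F =ᵐ[(haar p).restrict (Metric.closedBall 0 ((p : ℝ) ^ (R : ℤ)))] 0 := by
    intro R
    set B : Set ℚ_[p] := Metric.closedBall 0 ((p : ℝ) ^ (R : ℤ)) with hB
    have hint : Integrable F ((haar p).restrict B) :=
      hF.integrableOn_isCompact (isCompact_closedBall _ _)
    refine hint.ae_eq_zero_of_forall_setIntegral_eq_zero fun s hs hs' => ?_
    clear hs'
    induction s, hs using MeasurableSpace.induction_on_inter
      (h_eq := (BorelSpace.measurable_eq (α := ℚ_[p])).trans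
        isTopologicalBasis_closedBall_zpow.borel_eq_generateFrom)
      (isPiSystem_closedBall_zpow (p := p)) with
    | empty => simp
    | basic t ht =>
      obtain ⟨⟨b, k⟩, rfl⟩ := ht
      rw [Measure.restrict_restrict Metric.isClosed_closedBall.measurableSet]
      rcases IsUltrametricDist.closedBall_subset_trichotomy b 0 ((p : ℝ) ^ k) ((p : ℝ) ^ (R : ℤ))
        with h | h | h
      · rw [Set.inter_eq_left.2 h]; exact h0 _ _
      · rw [Set.inter_eq_right.2 h]; exact h0 _ _
      · rw [Set.disjoint_iff_inter_eq_empty.1 h]; simp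
    | compl t ht ih =>
      have h1 := integral_add_compl ht hint
      rw [ih, zero_add] at h1
      rw [h1]
      exact h0 _ _
    | iUnion f hd hm ih =>
      rw [integral_iUnion hm hd hint.integrableOn]
      simp [ih]
  have hU : (⋃ R : ℕ, Metric.closedBall (0 : ℚ_[p]) ((p : ℝ) ^ (R : ℤ))) = Set.univ := by
    refine Set.eq_univ_of_forall fun x => ?_
    obtain ⟨n, hn⟩ := pow_unbounded_of_one_lt ‖x‖ (one_lt_p (p := p))
    exact Set.mem_iUnion.2 ⟨n, by rw [mem_closedBall_zero_iff, zpow_natCast]; exact hn.le⟩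
  have := (ae_restrict_iUnion_iff (μ := haar p)
    (fun R : ℕ => Metric.closedBall (0 : ℚ_[p]) ((p : ℝ) ^ (R : ℤ))) (fun x => F x = 0)).2 hball
  rwa [hU, Measure.restrict_univ] at this

/-- The wavelets are complete in `L²(ℚ_p)`. -/
theorem eq_zero_of_inner_wavLp {u : L2 p} (h : ∀ g, inner ℂ u (wavLp g) = (0 : ℂ)) : u = 0 := by
  have hu : LocallyIntegrable u (haar p) := (Lp.memLp u).locallyIntegrable (by norm_num)
  set F : ℚ_[p] → ℂ := fun x => starRingEnd ℂ (u x) with hFdef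
  have hF : LocallyIntegrable F (haar p) := by
    refine ((Lp.memLp u).star).locallyIntegrable (by norm_num)
  have horth : ∀ g : Aff p, ∫ x, F x * wav g x ∂(haar p) = 0 := fun g => by
    rw [← inner_wavLp_right, h]
  have hpos := one_lt_p (p := p)
  have hzero : ∀ b, ∫ x in Metric.closedBall b 1, F x ∂(haar p) = 0 := by
    intro b
    by_contra hI
    set I := ∫ x in Metric.closedBall b 1, F x ∂(haar p) with hIdef
    have hIpos : 0 < ‖I‖ := norm_pos_iff.2 hI
    -- On the ball of radius p^(2m) the integral equals p^(2m) I, while Cauchy-Schwarz bounds it by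
    -- p^m ‖u‖; letting m grow contradicts I ≠ 0.
    have bound : ∀ m : ℕ, (p : ℝ) ^ m * ‖I‖ ≤ ‖u‖ := by
      intro m
      set s : Set ℚ_[p] := Metric.closedBall b ((p : ℝ) ^ (2 * m : ℤ)) with hs
      have hsm : MeasurableSet s := Metric.isClosed_closedBall.measurableSet
      have hμs : haar p s ≠ ⊤ := ((isCompact_closedBall b _).measure_lt_top (μ := haar p)).ne
      have h1 := L2.inner_indicatorConstLp_one (𝕜 := ℂ) hsm hμs u
      have h2 : ∫ x in s, F x ∂(haar p) = starRingEnd ℂ (∫ x in s, u x ∂(haar p)) :=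
        integral_conj
      have h3 : ‖∫ x in s, F x ∂(haar p)‖ ≤ (p : ℝ) ^ m * ‖u‖ := by
        rw [h2, RCLike.norm_conj, ← h1]
        refine (norm_inner_le_norm _ _).trans (le_of_eq ?_)
        congr 1
        rw [norm_indicatorConstLp (by norm_num) (by norm_num), norm_one, one_mul,
          hs, haar_real_closedBall_zpow]
        have : ((p : ℝ) ^ (2 * m : ℤ)) = ((p : ℝ) ^ m) ^ (2 : ℝ) := by
          rw [Real.rpow_two, ← pow_mul, ← zpow_natCast]; congr 1; push_cast; ring
        rw [this, ← Real.rpow_mul (by positivity)]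
        norm_num
      rw [hs, setIntegral_closedBall_zpow hF horth, norm_mul, norm_zpow, Complex.norm_natCast] at h3
      have h4 : (p : ℝ) ^ (2 * m : ℤ) = (p : ℝ) ^ m * (p : ℝ) ^ m := by
        rw [← pow_add, ← zpow_natCast]; congr 1; push_cast; ring
      rw [h4, mul_assoc] at h3
      exact le_of_mul_le_mul_left h3 (by positivity)
    obtain ⟨m, hm⟩ := pow_unbounded_of_one_lt (‖u‖ / ‖I‖) hpos
    rw [div_lt_iff₀ hIpos] at hm
    exact absurd (bound m) (not_le.2 hm)
  have hae := ae_eq_zero_of_setIntegral_closedBall hF fun b k => by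
    rw [setIntegral_closedBall_zpow hF horth, hzero, mul_zero]
  refine (Lp.eq_zero_iff_ae_eq_zero).2 ?_
  filter_upwards [hae] with x hx
  simpa [hFdef] using hx

/-- Parseval's identity for the wavelets, indexed by the lines which they span. -/
theorem hasSum_norm_inner_wavLp (u : L2 p) :
    HasSum (fun q : Aff p ⧸ phaseGroup p => ‖inner ℂ u (wavLp q.out)‖ ^ 2) (‖u‖ ^ 2) := by
  have hon : Orthonormal ℂ fun q : Aff p ⧸ phaseGroup p => wavLp q.out := by
    refine ⟨fun q => norm_wavLp _, fun q r hqr => inner_wavLp_eq_zero fun h => hqr ?_⟩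
    rw [← QuotientGroup.eq] at h
    simpa using h
  have hc : (Submodule.span ℂ (Set.range fun q : Aff p ⧸ phaseGroup p => wavLp q.out))ᗮ = ⊥ := by
    rw [Submodule.eq_bot_iff]
    intro w hw
    refine eq_zero_of_inner_wavLp fun g => ?_
    have h1 : ((g : Aff p ⧸ phaseGroup p).out)⁻¹ * g ∈ phaseGroup p := by
      rw [← QuotientGroup.eq]; simp
    have h2 := wavLp_mul_of_mem (g : Aff p ⧸ phaseGroup p).out h1
    rw [mul_inv_cancel_left] at h2
    rw [h2, inner_smul_right, (Submodule.mem_orthogonal' _ _).1 hw _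
      (Submodule.subset_span ⟨_, rfl⟩), mul_zero]
  let b := HilbertBasis.mkOfOrthogonalEqBot hon hc
  have hb : ⇑b = fun q : Aff p ⧸ phaseGroup p => wavLp q.out :=
    HilbertBasis.coe_mkOfOrthogonalEqBot hon hc
  have h := b.hasSum_inner_mul_inner u u
  have h' := (Complex.hasSum_iff _ _).1 h |>.1
  rw [hb] at h'
  convert h' using 1
  · funext q
    rw [← inner_conj_symm (wavLp q.out) u, Complex.mul_conj, Complex.normSq_eq_norm_sq,
      Complex.ofReal_re]
  · exact norm_sq_eq_re_inner (𝕜 := ℂ) u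

/-! ### Sums over coset spaces; congruence subgroups -/

section Sums

theorem HasSum.comp_fst {α β : Type*} [Finite β] {w : α → ℝ} (hw : 0 ≤ w) {S : ℝ}
    (h : HasSum w S) : HasSum (fun x : α × β => w x.1) (S * Nat.card β) := by
  have := Fintype.ofFinite β
  have h1 : HasSum (fun _ : β => (1 : ℝ)) (Nat.card β) := by
    simpa [Nat.card_eq_fintype_card] using hasSum_fintype fun _ : β => (1 : ℝ)
  have h2 := h.mul h1 (h.summable.mul_of_nonneg h1.summable hw fun _ => zero_le_one)
  simpa using h2

theorem HasSum.of_comp_fst {α β : Type*} [Finite β] [Nonempty β] {w : α → ℝ} (hw : 0 ≤ w) {S : ℝ}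
    (h : HasSum (fun x : α × β => w x.1) S) : HasSum w (S / Nat.card β) := by
  obtain ⟨b⟩ := ‹Nonempty β›
  have h1 : Summable w := h.summable.comp_injective (i := fun a => (a, b))
    fun a a' h => (Prod.ext_iff.1 h).1
  have h2 := HasSum.comp_fst (β := β) hw h1.hasSum
  have hN : (Nat.card β : ℝ) ≠ 0 := Nat.cast_ne_zero.mpr Nat.card_pos.ne'
  rw [h.unique h2, mul_div_cancel_right₀ _ hN]
  exact h1.hasSum

end Sums

section Cosets

variable {Γ : Type*} [Group Γ]

/-- Right translation by `s` as a bijection of coset spaces. -/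
def quotientMulRight {L L' : Subgroup Γ} (s : Γ) (h : ∀ x, x ∈ L ↔ s⁻¹ * x * s ∈ L') :
    Γ ⧸ L ≃ Γ ⧸ L' :=
  Quotient.congr (Equiv.mulRight s) fun a b => by
    change QuotientGroup.leftRel L a b ↔ QuotientGroup.leftRel L' (a * s) (b * s)
    rw [QuotientGroup.leftRel_apply, QuotientGroup.leftRel_apply, h]
    simp [mul_assoc]

theorem quotientMulRight_mk {L L' : Subgroup Γ} (s : Γ) (h : ∀ x, x ∈ L ↔ s⁻¹ * x * s ∈ L')
    (g : Γ) : quotientMulRight s h (g : Γ ⧸ L) = ((g * s : Γ) : Γ ⧸ L') := rfl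

theorem quotientEquivProdOfLE_mk_fst {L H : Subgroup Γ} (hLH : L ≤ H) (g : Γ) :
    (Subgroup.quotientEquivProdOfLE hLH (g : Γ ⧸ L)).1 = (g : Γ ⧸ H) := rfl

theorem finite_quotient_subgroupOf {L H K : Subgroup Γ} (hHK : H ≤ K)
    [Finite (K ⧸ L.subgroupOf K)] :
    Finite (H ⧸ L.subgroupOf H) :=
  Finite.of_injective _ (Subgroup.quotientSubgroupOfEmbeddingOfLE L hHK).injective

end Cosets

theorem p_zpow_neg_succ_lt_one (n : ℕ) : (p : ℝ) ^ (-((n + 1 : ℕ) : ℤ)) < 1 := by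
  rw [zpow_neg, zpow_natCast]
  exact inv_lt_one_of_one_lt₀ (one_lt_pow₀ one_lt_p (by omega))

/-- The principal congruence subgroup of level `n + 1`. -/
def congruenceGroup (p : ℕ) [Fact p.Prime] (n : ℕ) : Subgroup (Aff p) where
  carrier := {g | ‖(g.a : ℚ_[p]) - 1‖ ≤ (p : ℝ) ^ (-((n + 1 : ℕ) : ℤ)) ∧
    ‖g.b‖ ≤ (p : ℝ) ^ (-((n + 1 : ℕ) : ℤ))}
  one_mem' := by
    have : (0 : ℝ) ≤ (p : ℝ) ^ (-((n + 1 : ℕ) : ℤ)) := (p_zpow_pos _).le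
    simpa using this
  mul_mem' := by
    rintro g h ⟨hg, hg'⟩ ⟨hh, hh'⟩
    have ha := norm_eq_one_of_norm_sub_one_lt (hg.trans_lt (p_zpow_neg_succ_lt_one n))
    constructor
    · have : ((g * h).a : ℚ_[p]) - 1 = g.a * (h.a - 1) + (g.a - 1) := by
        rw [Aff.mul_a, Units.val_mul]; ring
      rw [this]
      refine (IsUltrametricDist.norm_add_le_max _ _).trans (max_le ?_ hg)
      rwa [norm_mul, ha, one_mul]
    · rw [Aff.mul_b]
      refine (IsUltrametricDist.norm_add_le_max _ _).trans (max_le hg' ?_)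
      rwa [norm_mul, ha, one_mul]
  inv_mem' := by
    rintro g ⟨hg, hg'⟩
    have ha := norm_eq_one_of_norm_sub_one_lt (hg.trans_lt (p_zpow_neg_succ_lt_one n))
    constructor
    · have : ((g⁻¹).a : ℚ_[p]) - 1 = -((g.a : ℚ_[p]) - 1) * (g.a : ℚ_[p])⁻¹ := by
        have := g.a.ne_zero
        rw [Aff.inv_a, Units.val_inv_eq_inv_val]; field_simp; ring
      rw [this, norm_mul, norm_neg, norm_inv, ha, inv_one, mul_one]
      exact hg
    · rw [Aff.inv_b, norm_mul, norm_neg, Units.val_inv_eq_inv_val, norm_inv, ha, inv_one, one_mul]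
      exact hg'

theorem mem_congruenceGroup {n : ℕ} {g : Aff p} :
    g ∈ congruenceGroup p n ↔ ‖(g.a : ℚ_[p]) - 1‖ ≤ (p : ℝ) ^ (-((n + 1 : ℕ) : ℤ)) ∧
      ‖g.b‖ ≤ (p : ℝ) ^ (-((n + 1 : ℕ) : ℤ)) := Iff.rfl

theorem congruenceGroup_le (n : ℕ) : congruenceGroup p n ≤ ballGroup p := fun _ h =>
  ⟨norm_eq_one_of_norm_sub_one_lt (h.1.trans_lt (p_zpow_neg_succ_lt_one n)),
    h.2.trans (p_zpow_neg_succ_lt_one n).le⟩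

/-- Normality in `ballGroup p` is what lets right translation by an element of that group act on the
cosets of the congruence subgroup. -/
theorem conj_mem_congruenceGroup {n : ℕ} {s x : Aff p} (hs : s ∈ ballGroup p)
    (hx : x ∈ congruenceGroup p n) : s⁻¹ * x * s ∈ congruenceGroup p n := by
  obtain ⟨hs1, hs2⟩ := hs
  obtain ⟨hx1, hx2⟩ := hx
  have hs0 := s.a.ne_zero
  constructor
  · have : ((s⁻¹ * x * s).a : ℚ_[p]) = x.a := by
      simp [mul_comm]
    rw [this]
    exact hx1
  · have : (s⁻¹ * x * s).b = (s.a : ℚ_[p])⁻¹ * (x.b + ((x.a : ℚ_[p]) - 1) * s.b) := by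
      simp; ring
    rw [this, norm_mul, norm_inv, hs1, inv_one, one_mul]
    refine (IsUltrametricDist.norm_add_le_max _ _).trans (max_le hx2 ?_)
    rw [norm_mul]
    exact (mul_le_of_le_one_right (norm_nonneg _) hs2).trans hx1

theorem conj_mem_congruenceGroup_iff {n : ℕ} {s : Aff p} (hs : s ∈ ballGroup p) (x : Aff p) :
    x ∈ congruenceGroup p n ↔ s⁻¹ * x * s ∈ congruenceGroup p n := by
  refine ⟨conj_mem_congruenceGroup hs, fun h => ?_⟩
  have := conj_mem_congruenceGroup ((ballGroup p).inv_mem hs) h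
  simpa [mul_assoc] using this

/-- Reduction of both coordinates modulo p^(n+1) separates the cosets. -/
theorem finite_ballGroup_quotient (n : ℕ) :
    Finite (ballGroup p ⧸ (congruenceGroup p n).subgroupOf (ballGroup p)) := by
  have : NeZero (p ^ (n + 1)) := ⟨pow_ne_zero _ hp.out.ne_zero⟩
  let φ : ballGroup p → ZMod (p ^ (n + 1)) × ZMod (p ^ (n + 1)) := fun k =>
    (PadicInt.toZModPow (n + 1) ⟨(k.1.a : ℚ_[p]), k.2.1.le⟩,
      PadicInt.toZModPow (n + 1) ⟨k.1.b, k.2.2⟩)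
  have key : ∀ x y : ℤ_[p], PadicInt.toZModPow (n + 1) x = PadicInt.toZModPow (n + 1) y →
      ‖(y : ℚ_[p]) - x‖ ≤ (p : ℝ) ^ (-((n + 1 : ℕ) : ℤ)) := by
    intro x y h
    have h1 : y - x ∈ RingHom.ker (PadicInt.toZModPow (p := p) (n + 1)) := by
      rw [RingHom.mem_ker, map_sub, h, sub_self]
    rw [PadicInt.ker_toZModPow, ← PadicInt.norm_le_pow_iff_mem_span_pow] at h1
    exact h1
  have hφ : ∀ k l, φ k = φ l → k⁻¹ * l ∈ (congruenceGroup p n).subgroupOf (ballGroup p) := by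
    rintro ⟨k, hk1, hk2⟩ ⟨l, hl1, hl2⟩ h
    obtain ⟨h1, h2⟩ := Prod.ext_iff.1 h
    have h1' := key _ _ h1
    have h2' := key _ _ h2
    have hk0 := k.a.ne_zero
    rw [Subgroup.mem_subgroupOf]
    constructor
    · have : (((k⁻¹ * l).a : ℚ_[p]ˣ) : ℚ_[p]) - 1 = (k.a : ℚ_[p])⁻¹ * (l.a - k.a) := by
        simp; field_simp
      change ‖(((k⁻¹ * l).a : ℚ_[p]ˣ) : ℚ_[p]) - 1‖ ≤ _
      rw [this, norm_mul, norm_inv, hk1, inv_one, one_mul]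
      exact h1'
    · have : (k⁻¹ * l).b = (k.a : ℚ_[p])⁻¹ * (l.b - k.b) := by
        simp; ring
      change ‖(k⁻¹ * l).b‖ ≤ _
      rw [this, norm_mul, norm_inv, hk1, inv_one, one_mul]
      exact h2'
  refine Finite.of_injective (fun q => φ q.out) fun q r h => ?_
  have := hφ _ _ h
  rw [← QuotientGroup.eq] at this
  simpa using this

/-- The affine maps which take the unit ball into itself. -/
def ballMonoid (p : ℕ) [Fact p.Prime] : Submonoid (Aff p) where
  carrier := {g | ‖(g.a : ℚ_[p])‖ ≤ 1 ∧ ‖g.b‖ ≤ 1}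
  one_mem' := by simp
  mul_mem' := by
    rintro g h ⟨hg, hg'⟩ ⟨hh, hh'⟩
    constructor
    · rw [Aff.mul_a, Units.val_mul, norm_mul]
      exact mul_le_one₀ hg (norm_nonneg _) hh
    · rw [Aff.mul_b]
      exact norm_add_le_one hg' (by rw [norm_mul]; exact mul_le_one₀ hg (norm_nonneg _) hh')

/-- The stabilizer of the line spanned by the wavelet of `h`. -/
def lineStabilizer (h : Aff p) : Subgroup (Aff p) :=
  (phaseGroup p).comap (MulAut.conj h⁻¹).toMonoidHom

theorem mem_lineStabilizer {h x : Aff p} : x ∈ lineStabilizer h ↔ h⁻¹ * x * h ∈ phaseGroup p := by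
  rw [lineStabilizer, Subgroup.mem_comap]
  simp

theorem conj_eq (h x : Aff p) : (((h⁻¹ * x * h).a : ℚ_[p]ˣ) : ℚ_[p]) = x.a ∧
    (h⁻¹ * x * h).b = (h.a : ℚ_[p])⁻¹ * (x.b + ((x.a : ℚ_[p]) - 1) * h.b) := by
  constructor
  · simp [mul_comm]
  · simp; ring

/-- Together with `finite_ballGroup_quotient`, this gives a congruence subgroup contained in the
line stabilizer finite index there. -/
theorem lineStabilizer_le {h : Aff p} (hh : h ∈ ballMonoid p) :
    lineStabilizer h ≤ ballGroup p := by
  intro x hx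
  obtain ⟨h1, h2⟩ := mem_lineStabilizer.1 hx
  obtain ⟨e1, e2⟩ := conj_eq h x
  rw [e1] at h1
  have h0 := h.a.ne_zero
  refine ⟨norm_eq_one_of_norm_sub_one_lt h1, ?_⟩
  have : x.b = h.a * (h⁻¹ * x * h).b - ((x.a : ℚ_[p]) - 1) * h.b := by
    rw [e2]; field_simp; ring
  rw [this]
  refine norm_sub_le_one ?_ ?_
  · rw [norm_mul]; exact mul_le_one₀ hh.1 (norm_nonneg _) h2
  · rw [norm_mul]; exact mul_le_one₀ h1.le (norm_nonneg _) hh.2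

/-- Conjugation by h divides translation parts by `h.a`. The strict inequality keeps the result of
norm below 1, so the wavelet is fixed outright and not just up to a phase. -/
theorem conj_mem_of_lt {h x : Aff p} {n : ℕ} (hh : h ∈ ballMonoid p)
    (hn : (p : ℝ) ^ (-((n + 1 : ℕ) : ℤ)) < ‖(h.a : ℚ_[p])‖) (hx : x ∈ congruenceGroup p n) :
    h⁻¹ * x * h ∈ phaseGroup p ∧ ‖(h⁻¹ * x * h).b‖ < 1 := by
  obtain ⟨hx1, hx2⟩ := hx
  obtain ⟨e1, e2⟩ := conj_eq h x
  have h0 := norm_pos_iff.2 h.a.ne_zero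
  have hb : ‖(h⁻¹ * x * h).b‖ < 1 := by
    rw [e2, norm_mul, norm_inv, inv_mul_lt_iff₀ h0, mul_one]
    refine (IsUltrametricDist.norm_add_le_max _ _).trans_lt (max_lt (hx2.trans_lt hn) ?_)
    rw [norm_mul]
    exact ((mul_le_of_le_one_right (norm_nonneg _) hh.2).trans hx1).trans_lt hn
  refine ⟨⟨?_, hb.le⟩, hb⟩
  rw [e1]
  exact hx1.trans_lt (p_zpow_neg_succ_lt_one n)

theorem chi_neg_div_eq_one {b : ℚ_[p]} (hb : ‖b‖ < 1) : chi p (-b / p) = 1 := by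
  rw [chi_eq_one_iff, norm_div_p_le_one_iff, norm_neg]; exact hb

theorem wav_mul_mul_of_lt {h x : Aff p} {n : ℕ} (hh : h ∈ ballMonoid p)
    (hn : (p : ℝ) ^ (-((n + 1 : ℕ) : ℤ)) < ‖(h.a : ℚ_[p])‖) (hx : x ∈ congruenceGroup p n)
    (g : Aff p) : wav (g * x * h) = wav (g * h) := by
  obtain ⟨h1, h2⟩ := conj_mem_of_lt hh hn hx
  have : g * x * h = g * h * (h⁻¹ * x * h) := by group
  rw [this, wav_mul_of_mem _ h1, chi_neg_div_eq_one h2, one_smul]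

theorem wavLp_mul_mul_of_lt {h x : Aff p} {n : ℕ} (hh : h ∈ ballMonoid p)
    (hn : (p : ℝ) ^ (-((n + 1 : ℕ) : ℤ)) < ‖(h.a : ℚ_[p])‖) (hx : x ∈ congruenceGroup p n)
    (g : Aff p) : wavLp (g * x * h) = wavLp (g * h) :=
  MemLp.toLp_congr _ _ (by rw [wav_mul_mul_of_lt hh hn hx])

theorem norm_inner_wavLp_mul_of_mem (u : L2 p) (g : Aff p) {x : Aff p} (hx : x ∈ phaseGroup p) :
    ‖inner ℂ u (wavLp (g * x))‖ = ‖inner ℂ u (wavLp g)‖ := by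
  rw [wavLp_mul_of_mem g hx, inner_smul_right, norm_mul, norm_chi, one_mul]

theorem congruenceGroup_le_lineStabilizer {h : Aff p} {n : ℕ} (hh : h ∈ ballMonoid p)
    (hn : (p : ℝ) ^ (-((n + 1 : ℕ) : ℤ)) < ‖(h.a : ℚ_[p])‖) :
    congruenceGroup p n ≤ lineStabilizer h := fun _ hx =>
  mem_lineStabilizer.2 (conj_mem_of_lt hh hn hx).1

/-! ### Diagonal and cross terms of the frame sum -/

/-- The sum of the squares of the coefficients with respect to the translates of one wavelet. -/
theorem exists_hasSum_coset {h : Aff p} {n : ℕ} (hh : h ∈ ballMonoid p)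
    (hn : (p : ℝ) ^ (-((n + 1 : ℕ) : ℤ)) < ‖(h.a : ℚ_[p])‖) :
    ∃ N : ℕ, 0 < N ∧ ∀ u : L2 p, HasSum (fun x : Aff p ⧸ congruenceGroup p n =>
      ‖inner ℂ u (wavLp (x.out * h))‖ ^ 2) (‖u‖ ^ 2 * N) := by
  have hfin := finite_ballGroup_quotient (p := p) n
  have hfin' : Finite (lineStabilizer h ⧸ (congruenceGroup p n).subgroupOf (lineStabilizer h)) :=
    finite_quotient_subgroupOf (lineStabilizer_le hh)
  refine ⟨Nat.card (lineStabilizer h ⧸ (congruenceGroup p n).subgroupOf (lineStabilizer h)),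
    Nat.card_pos, fun u => ?_⟩
  -- Right multiplication by h turns cosets of the line stabilizer into cosets of `phaseGroup p`,
  -- where Parseval applies; each line is then counted as often as the index of the congruence
  -- subgroup.
  let e : Aff p ⧸ lineStabilizer h ≃ Aff p ⧸ phaseGroup p :=
    quotientMulRight h fun x => mem_lineStabilizer
  have h1 := (e.hasSum_iff).2 (hasSum_norm_inner_wavLp u)
  have h2 := HasSum.comp_fst
    (β := lineStabilizer h ⧸ (congruenceGroup p n).subgroupOf (lineStabilizer h))
    (fun _ => sq_nonneg _) h1
  have h3 := ((Subgroup.quotientEquivProdOfLE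
    (congruenceGroup_le_lineStabilizer hh hn)).hasSum_iff).2 h2
  convert h3 using 1
  funext x
  obtain ⟨g, rfl⟩ := QuotientGroup.mk_surjective x
  simp only [Function.comp_apply]
  rw [quotientEquivProdOfLE_mk_fst, quotientMulRight_mk]
  obtain ⟨⟨y, hy⟩, hy'⟩ := QuotientGroup.mk_out_eq_mul (congruenceGroup p n) g
  obtain ⟨⟨z, hz⟩, hz'⟩ := QuotientGroup.mk_out_eq_mul (phaseGroup p) (g * h)
  rw [hy', hz', wavLp_mul_mul_of_lt hh hn hy, norm_inner_wavLp_mul_of_mem u _ hz]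

theorem inner_wavLp_mk_out {h : Aff p} {n : ℕ} (hh : h ∈ ballMonoid p)
    (hn : (p : ℝ) ^ (-((n + 1 : ℕ) : ℤ)) < ‖(h.a : ℚ_[p])‖)
    (u : L2 p) (g : Aff p) :
    inner ℂ u (wavLp ((g : Aff p ⧸ congruenceGroup p n).out * h)) =
      (inner ℂ u (wavLp (g * h)) : ℂ) := by
  obtain ⟨⟨y, hy⟩, hy'⟩ := QuotientGroup.mk_out_eq_mul (congruenceGroup p n) g
  rw [hy', wavLp_mul_mul_of_lt hh hn hy]

/-- The coefficients with respect to the translates of two wavelets which are not proportional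
are orthogonal. -/
theorem hasSum_coset_eq_zero {h : Aff p} {n : ℕ} (hh : h ∈ ballMonoid p)
    (hn : (p : ℝ) ^ (-((n + 1 : ℕ) : ℤ)) < ‖(h.a : ℚ_[p])‖)
    {h' : Aff p} (hh' : h' ∈ ballMonoid p)
    (hn' : (p : ℝ) ^ (-((n + 1 : ℕ) : ℤ)) < ‖(h'.a : ℚ_[p])‖)
    (hsep : h⁻¹ * h' ∉ phaseGroup p) (u : L2 p) :
    HasSum (fun x : Aff p ⧸ congruenceGroup p n =>
      inner ℂ u (wavLp (x.out * h)) * starRingEnd ℂ (inner ℂ u (wavLp (x.out * h')))) 0 := by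
  set X := fun x : Aff p ⧸ congruenceGroup p n =>
      inner ℂ u (wavLp (x.out * h)) * starRingEnd ℂ (inner ℂ u (wavLp (x.out * h'))) with hX
  have hs : Summable X := by
    obtain ⟨N, -, hN⟩ := exists_hasSum_coset hh hn
    obtain ⟨N', -, hN'⟩ := exists_hasSum_coset hh' hn'
    refine Summable.of_norm_bounded ((hN u).summable.add (hN' u).summable) fun x => ?_
    rw [hX, norm_mul, RCLike.norm_conj]
    nlinarith [sq_nonneg (‖inner ℂ u (wavLp (x.out * h))‖ - ‖inner ℂ u (wavLp (x.out * h'))‖),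
      sq_nonneg (‖inner ℂ u (wavLp (x.out * h))‖), sq_nonneg (‖inner ℂ u (wavLp (x.out * h'))‖)]
  obtain ⟨s, v, w, hv, hw, h1, h2, h3, h4⟩ := exists_separating hsep
  have hsK := h4 hh.1 hh.2 hh'.1 hh'.2
  -- Replacing x by x s changes the two wavelets by their eigenvalues under s. The absolutely
  -- convergent sum is invariant under this permutation yet multiplied by a scalar different from 1.
  let e : Aff p ⧸ congruenceGroup p n ≃ Aff p ⧸ congruenceGroup p n :=
    quotientMulRight s fun x => conj_mem_congruenceGroup_iff hsK x
  have hXe : ∀ x, X (e x) =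
      (chi p (-v.b / p) * starRingEnd ℂ (chi p (-w.b / p))) * X x := by
    intro x
    obtain ⟨g, rfl⟩ := QuotientGroup.mk_surjective x
    rw [quotientMulRight_mk]
    simp only [hX]
    rw [inner_wavLp_mk_out hh hn, inner_wavLp_mk_out hh hn, inner_wavLp_mk_out hh' hn',
      inner_wavLp_mk_out hh' hn', mul_assoc, mul_assoc, h1, h2, ← mul_assoc, ← mul_assoc,
      wavLp_mul_of_mem _ hv, wavLp_mul_of_mem _ hw, inner_smul_right, inner_smul_right, map_mul]
    ring
  have h5 := e.tsum_eq X
  simp_rw [hXe] at h5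
  rw [tsum_mul_left] at h5
  have h6 : (chi p (-v.b / p) * starRingEnd ℂ (chi p (-w.b / p)) - 1) * ∑' x, X x = 0 := by
    rw [sub_mul, h5, one_mul, sub_self]
  have h7 : chi p (-v.b / p) * starRingEnd ℂ (chi p (-w.b / p)) ≠ 1 := by
    rw [mul_comm]; exact conj_chi_mul_ne_one h3.symm
  rw [← (mul_eq_zero.1 h6).resolve_left (sub_ne_zero.2 h7)]
  exact hs.hasSum

/-! ### Orbits of finite combinations of wavelets -/

section Combination

variable {ι : Type*} [Fintype ι]

/-- A finite combination of wavelets. -/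
def wavComb (d : ι → ℂ) (h : ι → Aff p) : ℚ_[p] → ℂ := ∑ i, d i • wav (h i)

theorem smul_wavComb (d : ι → ℂ) (h : ι → Aff p) (g : Aff p) :
    g • wavComb d h = wavComb d fun i => g * h i := by
  rw [wavComb, smul_sum]
  exact Finset.sum_congr rfl fun i _ => by rw [smul_const_mul, smul_wav]

theorem continuous_wavComb (d : ι → ℂ) (h : ι → Aff p) : Continuous (wavComb d h) := by
  have h1 := continuous_finsetSum (Finset.univ : Finset ι)
    fun i _ => (continuous_wav (h i)).const_smul (d i)
  convert h1 using 1
  funext x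
  rw [wavComb, Finset.sum_apply]

theorem memLp_wavComb (d : ι → ℂ) (h : ι → Aff p) : MemLp (wavComb d h) 2 (haar p) :=
  memLp_finsetSum' _ fun i _ => (memLp_wav (h i)).const_smul (d i)

theorem integrable_wavComb (d : ι → ℂ) (h : ι → Aff p) : Integrable (wavComb d h) (haar p) :=
  integrable_finsetSum' _ fun i _ => (integrable_wav (h i)).smul (d i)

theorem integral_wavComb (d : ι → ℂ) (h : ι → Aff p) : ∫ x, wavComb d h x ∂(haar p) = 0 := by
  simp only [wavComb, Finset.sum_apply]
  rw [integral_finsetSum _ fun i _ => (integrable_wav (h i)).smul (d i)]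
  simp [integral_const_mul, integral_wav]

theorem toLp_wavComb (d : ι → ℂ) (h : ι → Aff p) :
    (memLp_wavComb d h).toLp (wavComb d h) = ∑ i, d i • wavLp (h i) := by
  refine Lp.ext ?_
  have h1 : ∀ᵐ x ∂(haar p), ∀ i, (wavLp (h i)) x = wav (h i) x :=
    ae_all_iff.2 fun i => (memLp_wav (h i)).coeFn_toLp
  have h2 : ∀ᵐ x ∂(haar p), ∀ i, (d i • wavLp (h i) : L2 p) x = d i • (wavLp (h i)) x :=
    ae_all_iff.2 fun i => Lp.coeFn_smul _ _
  filter_upwards [(memLp_wavComb d h).coeFn_toLp, h1, h2,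
    Lp.coeFn_finsetSum Finset.univ fun i => d i • wavLp (h i)] with x e1 e2 e3 e4
  rw [e1, e4, wavComb, Finset.sum_apply, Finset.sum_apply]
  exact Finset.sum_congr rfl fun i _ => by rw [e3 i, e2 i, Pi.smul_apply]

theorem norm_toLp_smul_wavComb (d : ι → ℂ) (h : ι → Aff p) (g : Aff p) :
    ‖∑ i, d i • wavLp (g * h i)‖ = ‖∑ i, d i • wavLp (h i)‖ := by
  have : ‖∑ i, d i • wavLp (g * h i)‖ ^ 2 = ‖∑ i, d i • wavLp (h i)‖ ^ 2 := by
    rw [norm_sq_eq_re_inner (𝕜 := ℂ), norm_sq_eq_re_inner (𝕜 := ℂ)]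
    simp only [sum_inner, inner_sum, inner_smul_left, inner_smul_right, inner_wavLp_mul]
  exact (pow_left_inj₀ (norm_nonneg _) (norm_nonneg _) two_ne_zero).1 this

theorem wavComb_eq_zero_of_lt {d : ι → ℂ} {h : ι → Aff p} (hM : ∀ i, h i ∈ ballMonoid p)
    {x : ℚ_[p]} (hx : ¬ ‖x‖ ≤ 1) : wavComb d h x = 0 := by
  rw [wavComb, Finset.sum_apply]
  refine Finset.sum_eq_zero fun i _ => ?_
  rw [Pi.smul_apply, wav_apply_of_lt, smul_zero]
  intro h'
  exact hx (by simpa using norm_add_le_one (h'.trans (hM i).1) (hM i).2)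

/-- The stabilizer of a nonzero function supported in the unit ball preserves this ball. -/
theorem stabilizer_le_ballGroup {f : ℚ_[p] → ℂ} (hc : Continuous f) (hf : f ≠ 0)
    (hs : ∀ x, ¬ ‖x‖ ≤ 1 → f x = 0) : MulAction.stabilizer (Aff p) f ≤ ballGroup p := by
  have hcs : HasCompactSupport f := HasCompactSupport.intro (isCompact_closedBall 0 1)
    fun x hx => hs x fun h => hx (mem_closedBall_zero_iff.2 h)
  obtain ⟨x₀, hx₀⟩ := hc.norm.exists_forall_ge_of_hasCompactSupport hcs.norm
  have hpos : 0 < ‖f x₀‖ := by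
    obtain ⟨y, hy⟩ := Function.ne_iff.1 hf
    exact (norm_pos_iff.2 hy).trans_le (hx₀ y)
  -- At a maximum x₀ of |f|, invariance under g with |a| > 1 would make |f| larger still at (x₀ -
  -- b)/a. The inverse of g then excludes |a| < 1.
  have key : ∀ g ∈ MulAction.stabilizer (Aff p) f, ‖(g.a : ℚ_[p])‖ ≤ 1 := by
    intro g hg
    have h1 := congrArg norm (congrFun (MulAction.mem_stabilizer_iff.1 hg) x₀)
    have ha : 0 < ‖(g.a : ℚ_[p])‖ := norm_pos_iff.2 g.a.ne_zero
    rw [smul_apply', norm_mul, Complex.norm_real, Real.norm_of_nonneg (by positivity)] at h1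
    by_contra hlt
    have h2 : ‖(g.a : ℚ_[p])‖ ^ (-(1 / 2) : ℝ) < 1 :=
      Real.rpow_lt_one_of_one_lt_of_neg (not_le.1 hlt) (by norm_num)
    have h3 := hx₀ ((x₀ - g.b) / g.a)
    have h4 := Real.rpow_pos_of_pos ha (-(1 / 2) : ℝ)
    nlinarith
  intro g hg
  have ha : 0 < ‖(g.a : ℚ_[p])‖ := norm_pos_iff.2 g.a.ne_zero
  have h1 : ‖(g.a : ℚ_[p])‖ = 1 := by
    refine le_antisymm (key g hg) ?_
    have := key _ ((MulAction.stabilizer (Aff p) f).inv_mem hg)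
    rw [Aff.inv_a, Units.val_inv_eq_inv_val, norm_inv] at this
    exact (inv_le_one₀ ha).1 this
  refine ⟨h1, ?_⟩
  -- Both x₀ and (x₀ - b)/a lie in the support, hence in the unit ball; since |a| = 1, so does b.
  have h2 := congrFun (MulAction.mem_stabilizer_iff.1 hg) x₀
  have hx1 : ‖x₀‖ ≤ 1 := by
    by_contra hx
    rw [hs _ hx, norm_zero] at hpos
    exact lt_irrefl _ hpos
  have hx2 : ‖(x₀ - g.b) / (g.a : ℚ_[p])‖ ≤ 1 := by
    by_contra hx
    rw [smul_apply', hs _ hx, mul_zero] at h2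
    rw [← h2, norm_zero] at hpos
    exact lt_irrefl _ hpos
  rw [norm_div, h1, div_one] at hx2
  simpa using norm_sub_le_one hx1 hx2

theorem exists_level_lt (h : ι → Aff p) :
    ∃ n : ℕ, ∀ i, (p : ℝ) ^ (-((n + 1 : ℕ) : ℤ)) < ‖((h i).a : ℚ_[p])‖ := by
  have h1 : ∀ i, ∃ n : ℕ, ((p : ℝ)⁻¹) ^ n < ‖((h i).a : ℚ_[p])‖ := fun i =>
    exists_pow_lt_of_lt_one (norm_pos_iff.2 (h i).a.ne_zero) (inv_lt_one_of_one_lt₀ one_lt_p)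
  choose n hn using h1
  refine ⟨Finset.univ.sup n, fun i => lt_of_le_of_lt ?_ (hn i)⟩
  rw [zpow_neg, zpow_natCast, ← inv_pow]
  exact pow_le_pow_of_le_one (inv_nonneg.2 (Nat.cast_nonneg p))
    (inv_le_one_of_one_le₀ one_lt_p.le)
    ((Finset.le_sup (Finset.mem_univ i)).trans (Nat.le_succ _))

/-- The translates of a combination of wavelets, over the cosets of a small subgroup, form a tight
frame. -/
theorem exists_hasSum_coset_wavComb {d : ι → ℂ} {h : ι → Aff p} (hM : ∀ i, h i ∈ ballMonoid p)
    (hsep : ∀ i j, i ≠ j → (h i)⁻¹ * h j ∉ phaseGroup p) (hd : ∃ i, d i ≠ 0) {n : ℕ}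
    (hn : ∀ i, (p : ℝ) ^ (-((n + 1 : ℕ) : ℤ)) < ‖((h i).a : ℚ_[p])‖) :
    ∃ A : ℝ, 0 < A ∧ ∀ u : L2 p, HasSum (fun x : Aff p ⧸ congruenceGroup p n =>
      ‖inner ℂ u (∑ i, d i • wavLp (x.out * h i))‖ ^ 2) (‖u‖ ^ 2 * A) := by
  classical
  choose N hNpos hN using fun i => exists_hasSum_coset (hM i) (hn i)
  refine ⟨∑ i, ‖d i‖ ^ 2 * N i, ?_, fun u => ?_⟩
  · obtain ⟨i, hi⟩ := hd
    refine Finset.sum_pos' (fun j _ => by positivity) ⟨i, Finset.mem_univ i, ?_⟩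
    have := norm_pos_iff.2 hi
    have := hNpos i
    positivity
  -- The squared inner product is expanded as a double sum over i and j, of which only the diagonal
  -- survives summation over the cosets.
  · have h1 : ∀ i j, HasSum (fun x : Aff p ⧸ congruenceGroup p n =>
        d i * starRingEnd ℂ (d j) * (inner ℂ u (wavLp (x.out * h i)) *
          starRingEnd ℂ (inner ℂ u (wavLp (x.out * h j)))))
        (if i = j then ((‖u‖ ^ 2 * (‖d i‖ ^ 2 * N i) : ℝ) : ℂ) else 0) := by
      intro i j
      split_ifs with hij
      · subst hij
        have h2 := (Complex.hasSum_ofReal.2 (hN i u)).mul_left ((‖d i‖ ^ 2 : ℝ) : ℂ)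
        have h3 : ((‖u‖ ^ 2 * (‖d i‖ ^ 2 * N i) : ℝ) : ℂ) =
            ((‖d i‖ ^ 2 : ℝ) : ℂ) * ((‖u‖ ^ 2 * N i : ℝ) : ℂ) := by push_cast; ring
        rw [h3]
        simp_rw [Complex.mul_conj, Complex.normSq_eq_norm_sq]
        exact h2
      · have h2 := (hasSum_coset_eq_zero (hM i) (hn i) (hM j) (hn j) (hsep i j hij) u).mul_left
          (d i * starRingEnd ℂ (d j))
        rwa [mul_zero] at h2
    have h2 := hasSum_sum (s := Finset.univ) fun i _ =>
      hasSum_sum (s := Finset.univ) fun j _ => h1 i j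
    simp only [Finset.sum_ite_eq, Finset.mem_univ, if_true] at h2
    rw [← Complex.hasSum_ofReal]
    convert h2 using 1
    · funext x
      rw [← Complex.normSq_eq_norm_sq, ← Complex.mul_conj, inner_sum, map_sum,
        Finset.sum_mul_sum]
      refine Finset.sum_congr rfl fun i _ => Finset.sum_congr rfl fun j _ => ?_
      rw [inner_smul_right, inner_smul_right, map_mul]
      ring
    · rw [Finset.mul_sum]; push_cast; rfl

theorem congruenceGroup_le_stabilizer {d : ι → ℂ} {h : ι → Aff p} (hM : ∀ i, h i ∈ ballMonoid p)
    {n : ℕ} (hn : ∀ i, (p : ℝ) ^ (-((n + 1 : ℕ) : ℤ)) < ‖((h i).a : ℚ_[p])‖) :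
    congruenceGroup p n ≤ MulAction.stabilizer (Aff p) (wavComb d h) := by
  intro x hx
  rw [MulAction.mem_stabilizer_iff, smul_wavComb]
  refine Finset.sum_congr rfl fun i _ => ?_
  have := wav_mul_mul_of_lt (hM i) (hn i) hx 1
  rw [one_mul, one_mul] at this
  change d i • wav (x * h i) = _
  rw [this]

theorem exists_eq_wavComb_of_mem_orbit {d : ι → ℂ} {h : ι → Aff p} {φ : ℚ_[p] → ℂ}
    (hφ : φ ∈ MulAction.orbit (Aff p) (wavComb d h)) :
    ∃ g : Aff p, φ = wavComb d fun i => g * h i := by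
  obtain ⟨g, rfl⟩ := hφ
  exact ⟨g, smul_wavComb d h g⟩

theorem memLp_of_mem_orbit {d : ι → ℂ} {h : ι → Aff p} {φ : ℚ_[p] → ℂ}
    (hφ : φ ∈ MulAction.orbit (Aff p) (wavComb d h)) : MemLp φ 2 (haar p) := by
  obtain ⟨g, rfl⟩ := exists_eq_wavComb_of_mem_orbit hφ
  exact memLp_wavComb _ _

/-- The orbit of a combination of wavelets is a uniform tight frame. -/
theorem isUniformTightFrame_orbit {d : ι → ℂ} {h : ι → Aff p} (hM : ∀ i, h i ∈ ballMonoid p)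
    (hsep : ∀ i j, i ≠ j → (h i)⁻¹ * h j ∉ phaseGroup p) (h0 : wavComb d h ≠ 0) :
    IsUniformTightFrameL2 (p := p)
      (Subtype.val : MulAction.orbit (Aff p) (wavComb d h) → ℚ_[p] → ℂ) := by
  have hd : ∃ i, d i ≠ 0 := by
    by_contra hd
    push Not at hd
    exact h0 (Finset.sum_eq_zero fun i _ => by rw [hd i, zero_smul])
  obtain ⟨n, hn⟩ := exists_level_lt h
  obtain ⟨A, hA, hsum⟩ := exists_hasSum_coset_wavComb hM hsep hd hn
  have hfin := finite_ballGroup_quotient (p := p) n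
  have hLS := congruenceGroup_le_stabilizer (d := d) hM hn
  have hSK : MulAction.stabilizer (Aff p) (wavComb d h) ≤ ballGroup p :=
    stabilizer_le_ballGroup (continuous_wavComb d h) h0 fun x hx => wavComb_eq_zero_of_lt hM hx
  have hfin' : Finite (MulAction.stabilizer (Aff p) (wavComb d h) ⧸
      (congruenceGroup p n).subgroupOf (MulAction.stabilizer (Aff p) (wavComb d h))) :=
    finite_quotient_subgroupOf hSK
  have htoLp : ∀ (φ : ℚ_[p] → ℂ) (hφ : MemLp φ 2 (haar p)) (g : Aff p), φ = g • wavComb d h →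
      hφ.toLp φ = ∑ i, d i • wavLp (g * h i) := by
    intro φ hφ g hg
    rw [smul_wavComb] at hg
    subst hg
    exact toLp_wavComb _ _
  refine ⟨fun φ => memLp_of_mem_orbit φ.2, ⟨A / Nat.card (MulAction.stabilizer (Aff p) (wavComb d h) ⧸
      (congruenceGroup p n).subgroupOf (MulAction.stabilizer (Aff p) (wavComb d h))),
      div_pos hA (Nat.cast_pos.2 Nat.card_pos), fun u => ?_⟩, ?_⟩
  · let e := MulAction.orbitEquivQuotientStabilizer (Aff p) (wavComb d h)
    rw [← e.symm.hasSum_iff, div_mul_eq_mul_div, mul_comm A]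
    -- The sum over the congruence cosets counts each point of the orbit as often as the finite
    -- index of the congruence subgroup in the stabilizer, so the frame bound is divided by that
    -- index.
    refine HasSum.of_comp_fst (β := MulAction.stabilizer (Aff p) (wavComb d h) ⧸
      (congruenceGroup p n).subgroupOf (MulAction.stabilizer (Aff p) (wavComb d h)))
      (fun _ => sq_nonneg _) ?_
    rw [← (Subgroup.quotientEquivProdOfLE hLS).hasSum_iff]
    convert hsum u using 1
    funext x
    obtain ⟨g, rfl⟩ := QuotientGroup.mk_surjective x
    simp only [Function.comp_apply]
    rw [quotientEquivProdOfLE_mk_fst]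
    obtain ⟨⟨y, hy⟩, hy'⟩ := QuotientGroup.mk_out_eq_mul (congruenceGroup p n) g
    rw [htoLp _ _ g (MulAction.orbitEquivQuotientStabilizer_symm_apply _ _ g), hy']
    simp_rw [fun i => wavLp_mul_mul_of_lt (hM i) (hn i) hy g]
  · have hnorm : ∀ φ : MulAction.orbit (Aff p) (wavComb d h),
        ‖(memLp_of_mem_orbit φ.2).toLp φ.1‖ = ‖∑ i, d i • wavLp (h i)‖ := by
      intro φ
      obtain ⟨g, hg⟩ := φ.2
      rw [htoLp _ _ g hg.symm, norm_toLp_smul_wavComb]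
    exact fun φ ψ => (hnorm φ).trans (hnorm ψ).symm

end Combination

/-- Every combination of wavelets has, after a dilation, an expansion in wavelets which are
supported in the unit ball and pairwise not proportional. -/
theorem exists_smul_sum_eq_wavComb {ι : Type*} (s : Finset ι) (c : ι → ℂ) (k : ι → Aff p) :
    ∃ (g : Aff p) (t : Finset (Aff p ⧸ phaseGroup p)) (d : t → ℂ) (h : t → Aff p),
      g • (∑ i ∈ s, c i • wav (k i)) = wavComb d h ∧ (∀ i, h i ∈ ballMonoid p) ∧
      ∀ i j, i ≠ j → (h i)⁻¹ * h j ∉ phaseGroup p := by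
  obtain ⟨m, hm⟩ : ∃ m : ℕ, ∀ i ∈ s, ‖((k i).a : ℚ_[p])‖ ≤ (p : ℝ) ^ m ∧
      ‖(k i).b‖ ≤ (p : ℝ) ^ m := by
    choose n hn using fun i => pow_unbounded_of_one_lt
      (max ‖((k i).a : ℚ_[p])‖ ‖(k i).b‖) (one_lt_p (p := p))
    refine ⟨s.sup n, fun i hi => ?_⟩
    have h1 : (p : ℝ) ^ n i ≤ (p : ℝ) ^ s.sup n :=
      pow_le_pow_right₀ one_lt_p.le (Finset.le_sup hi)
    exact ⟨(le_max_left _ _).trans ((hn i).le.trans h1),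
      (le_max_right _ _).trans ((hn i).le.trans h1)⟩
  set g : Aff p := ⟨pPow p m, 0⟩ with hg
  have hga : ‖(g.a : ℚ_[p])‖ = ((p : ℝ) ^ m)⁻¹ := by
    rw [hg, pPow, zpow_natCast, Units.val_pow_eq_pow_val, Units.val_mk0, norm_pow, Padic.norm_p,
      inv_pow]
  have hpm : (0 : ℝ) < (p : ℝ) ^ m := by have := one_lt_p (p := p); positivity
  have hgk : ∀ i ∈ s, g * k i ∈ ballMonoid p := by
    intro i hi
    obtain ⟨h1, h2⟩ := hm i hi
    constructor
    · rw [Aff.mul_a, Units.val_mul, norm_mul, hga, inv_mul_le_iff₀ hpm, mul_one]; exact h1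
    · rw [Aff.mul_b]
      change ‖0 + (g.a : ℚ_[p]) * _‖ ≤ 1
      rw [zero_add, norm_mul, hga, inv_mul_le_iff₀ hpm, mul_one]; exact h2
  -- Expanding in one chosen representative per coset merges proportional wavelets, so distinct
  -- terms are automatically non-proportional. The representative stays in `ballMonoid p`, which
  -- contains `phaseGroup p`.
  let Q : Set (Aff p ⧸ phaseGroup p) := {q | q.out ∈ ballMonoid p}
  have hmem : g • (∑ i ∈ s, c i • wav (k i)) ∈
      Submodule.span ℂ ((fun q : Aff p ⧸ phaseGroup p => wav q.out) '' Q) := by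
    rw [smul_sum]
    refine Submodule.sum_mem _ fun i hi => ?_
    rw [smul_const_mul, smul_wav]
    refine Submodule.smul_mem _ _ ?_
    obtain ⟨⟨u, hu⟩, hu'⟩ := QuotientGroup.mk_out_eq_mul (phaseGroup p) (g * k i)
    have hw := wav_mul_of_mem (g * k i) hu
    change Quotient.out _ = g * k i * u at hu'
    rw [← hu'] at hw
    have huM : u ∈ ballMonoid p := ⟨(norm_eq_one_of_norm_sub_one_lt hu.1).le, hu.2⟩
    have hQ : ((g * k i : Aff p) : Aff p ⧸ phaseGroup p) ∈ Q := by
      change Quotient.out _ ∈ ballMonoid p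
      rw [hu']
      exact (ballMonoid p).mul_mem (hgk i hi) huM
    have hw' : wav (g * k i) = (chi p (-u.b / p))⁻¹ •
        wav ((g * k i : Aff p) : Aff p ⧸ phaseGroup p).out := by
      rw [hw, inv_smul_smul₀ (chi_ne_zero _)]
    rw [hw']
    exact Submodule.smul_mem _ _ (Submodule.subset_span ⟨_, hQ, rfl⟩)
  obtain ⟨t, htQ, d, hd⟩ := (Submodule.mem_span_image_iff_exists_fun ℂ).1 hmem
  refine ⟨g, t, d, fun q => q.1.out, hd.symm, fun q => htQ q.2, fun q r hqr h => hqr ?_⟩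
  rw [← QuotientGroup.eq] at h
  exact Subtype.ext (by simpa using h)

/-! ### Families with constant multiplicity -/

section Copies

theorem isCopies_of_fiber {ι X : Type*} {N : ℕ} {u : ι → X} {S : Set X} (hS : ∀ i, u i ∈ S)
    (h : ∀ s ∈ S, Nonempty ({i // u i = s} ≃ Fin N)) : IsCopies N u S := by
  have e := fun s : S => (h s.1 s.2).some
  let v : ι → S := fun i => ⟨u i, hS i⟩
  let e1 : (Σ s : S, {i // v i = s}) ≃ Σ _ : S, Fin N := Equiv.sigmaCongrRight fun s =>
    (Equiv.subtypeEquivRight fun i => Subtype.ext_iff).trans (e s)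
  exact ⟨((Equiv.sigmaFiberEquiv v).symm.trans e1).trans (Equiv.sigmaEquivProd S (Fin N)),
    fun i => rfl⟩

theorem IsCopies.injective_and_range {ι X : Type*} {u : ι → X} {S : Set X} (h : IsCopies 1 u S) :
    Function.Injective u ∧ Set.range u = S := by
  obtain ⟨e, he⟩ := h
  refine ⟨fun i j hij => e.injective (Prod.ext (Subtype.ext ?_) (Subsingleton.elim _ _)), ?_⟩
  · rw [← he, ← he, hij]
  · ext s
    constructor
    · rintro ⟨i, rfl⟩
      rw [he]
      exact (e i).1.2
    · intro hs
      exact ⟨e.symm (⟨s, hs⟩, 0), by rw [he, Equiv.apply_symm_apply]⟩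

theorem IsCopies.isUniformTightFrameL2 {ι : Type*} {u : ι → ℚ_[p] → ℂ} {S : Set (ℚ_[p] → ℂ)} {N : ℕ}
    (hN : 0 < N) (h : IsCopies N u S)
    (hS : IsUniformTightFrameL2 (Subtype.val : S → ℚ_[p] → ℂ)) : IsUniformTightFrameL2 u := by
  obtain ⟨e, he⟩ := h
  obtain ⟨hmem, ⟨A, hA, hsum⟩, hnorm⟩ := hS
  obtain rfl : u = fun i => ((e i).1 : ℚ_[p] → ℂ) := funext he
  refine ⟨fun i => hmem (e i).1, ⟨A * N, by positivity, fun g => ?_⟩, fun i k => hnorm _ _⟩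
  have h1 := HasSum.comp_fst (β := Fin N) (fun _ => sq_nonneg _) (hsum g)
  rw [Nat.card_fin, mul_right_comm] at h1
  exact e.hasSum_iff.2 h1

theorem IsUniformTightFrameL2.isFrameL2 {ι : Type*} {u : ι → ℚ_[p] → ℂ}
    (h : IsUniformTightFrameL2 u) : IsFrameL2 u := by
  obtain ⟨hmem, ⟨A, hA, hsum⟩, -⟩ := h
  exact ⟨hmem, A, A, hA, hA, fun g =>
    ⟨(hsum g).summable, (hsum g).tsum_eq.ge, (hsum g).tsum_eq.le⟩⟩

end Copies

/-! ### Counting representatives and enumerating the orbit -/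

theorem fracReps_eq_of_norm_sub_le_one {q r : ℚ} (hq : q ∈ FracReps p) (hr : r ∈ FracReps p)
    (h : ‖(q : ℚ_[p]) - (r : ℚ_[p])‖ ≤ 1) : q = r := by
  obtain ⟨k, m, hm, rfl⟩ := hq
  obtain ⟨l, n, hn, rfl⟩ := hr
  have hp0 := cast_p_ne_zero (p := p)
  have hpq : (p : ℚ) ≠ 0 := Nat.cast_ne_zero.mpr hp.out.ne_zero
  have h1 : ‖((m * p ^ l - n * p ^ k : ℤ) : ℚ_[p]) / (p : ℚ_[p]) ^ (k + l)‖ ≤ 1 := by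
    convert h using 2
    push_cast
    field_simp
    ring
  obtain ⟨d, hd⟩ := exists_int_of_norm_div_le_one _ _ h1
  have hmod : m * p ^ l ≡ n * p ^ k [MOD p ^ (k + l)] := by
    rw [← Int.natCast_modEq_iff]
    refine (Int.modEq_iff_dvd.2 ⟨-d, ?_⟩)
    push_cast
    linear_combination -hd
  have hpos : 0 < p := hp.out.pos
  have h2 := hmod.eq_of_lt_of_lt
    (by rw [pow_add]; exact Nat.mul_lt_mul_of_pos_right hm (pow_pos hpos l))
    (by rw [pow_add, mul_comm (p ^ k)]; exact Nat.mul_lt_mul_of_pos_right hn (pow_pos hpos k))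
  have h3 : (m : ℚ) * p ^ l = n * p ^ k := by exact_mod_cast h2
  field_simp
  linear_combination h3

/-- A ball of radius `p ^ r` contains exactly `p ^ r` representatives of `ℚ_p / ℤ_p`. -/
theorem nonempty_fracReps_ball_equiv (y : ℚ_[p]) (r : ℕ) :
    Nonempty ({n : FracReps p // ‖y - ((n : ℚ) : ℚ_[p])‖ ≤ (p : ℝ) ^ r} ≃ Fin (p ^ r)) := by
  have hp0 := cast_p_ne_zero (p := p)
  have hpr : (0 : ℝ) < (p : ℝ) ^ r := pow_pos (by exact_mod_cast hp.out.pos) r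
  have hpr1 : (1 : ℝ) ≤ (p : ℝ) ^ r := one_le_pow₀ one_lt_p.le
  choose q hq hqn using exists_fracRep p
  have hnorm : ∀ m : ℕ, ‖(m : ℚ_[p]) / (p : ℚ_[p]) ^ r‖ ≤ (p : ℝ) ^ r := by
    intro m
    rw [norm_div, norm_pow, Padic.norm_p, inv_pow, div_inv_eq_mul]
    exact mul_le_of_le_one_left hpr.le (by exact_mod_cast Padic.norm_int_le_one (p := p) m)
  have hball : ∀ m : ℕ,
      ‖y - ((q (y + (m : ℚ_[p]) / (p : ℚ_[p]) ^ r) : ℚ) : ℚ_[p])‖ ≤ (p : ℝ) ^ r := by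
    intro m
    have : y - ((q (y + (m : ℚ_[p]) / (p : ℚ_[p]) ^ r) : ℚ) : ℚ_[p]) =
        (y + (m : ℚ_[p]) / (p : ℚ_[p]) ^ r -
          ((q (y + (m : ℚ_[p]) / (p : ℚ_[p]) ^ r) : ℚ) : ℚ_[p])) +
          -((m : ℚ_[p]) / (p : ℚ_[p]) ^ r) := by ring
    rw [this]
    refine (IsUltrametricDist.norm_add_le_max _ _).trans (max_le ((hqn _).trans hpr1) ?_)
    rw [norm_neg]
    exact hnorm m
  -- The classes m/p^r with 0 ≤ m < p^r exhaust the ball of radius p^r about 0 modulo the p-adic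
  -- integers; they are shifted by y.
  let φ : Fin (p ^ r) → {n : FracReps p // ‖y - ((n : ℚ) : ℚ_[p])‖ ≤ (p : ℝ) ^ r} := fun m =>
    ⟨⟨q (y + ((m : ℕ) : ℚ_[p]) / (p : ℚ_[p]) ^ r), hq _⟩, hball m⟩
  refine ⟨(Equiv.ofBijective φ ⟨?_, ?_⟩).symm⟩
  · rintro ⟨m, hm⟩ ⟨n, hn⟩ hmn
    have h1 : q (y + (m : ℚ_[p]) / (p : ℚ_[p]) ^ r) = q (y + (n : ℚ_[p]) / (p : ℚ_[p]) ^ r) :=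
      congrArg (fun t => ((t.1 : FracReps p) : ℚ)) hmn
    have h2 := hqn (y + (m : ℚ_[p]) / (p : ℚ_[p]) ^ r)
    rw [h1] at h2
    have h3 := norm_sub_le_one h2 (hqn (y + (n : ℚ_[p]) / (p : ℚ_[p]) ^ r))
    have h4 : ‖((m - n : ℤ) : ℚ_[p]) / (p : ℚ_[p]) ^ r‖ ≤ 1 := by
      convert h3 using 2
      push_cast
      ring
    obtain ⟨d, hd⟩ := exists_int_of_norm_div_le_one _ _ h4
    have hmod : m ≡ n [MOD p ^ r] := by
      rw [← Int.natCast_modEq_iff]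
      refine (Int.modEq_iff_dvd.2 ⟨-d, ?_⟩)
      push_cast
      linear_combination -hd
    exact Fin.ext (hmod.eq_of_lt_of_lt hm hn)
  · rintro ⟨⟨n, hn⟩, hny⟩
    have hz : ‖(p : ℚ_[p]) ^ r * ((n : ℚ_[p]) - y)‖ ≤ 1 := by
      rw [norm_mul, norm_pow, Padic.norm_p, inv_pow, inv_mul_le_iff₀ hpr, mul_one, ← norm_neg,
        neg_sub]
      exact hny
    obtain ⟨z, hz⟩ : ∃ z : ℤ_[p], (z : ℚ_[p]) = (p : ℚ_[p]) ^ r * ((n : ℚ_[p]) - y) :=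
      ⟨⟨_, hz⟩, rfl⟩
    obtain ⟨c, hc⟩ := Ideal.mem_span_singleton.mp (PadicInt.appr_spec r z)
    have hc' : (p : ℚ_[p]) ^ r * ((n : ℚ_[p]) - y) - (z.appr r : ℚ_[p]) =
        (p : ℚ_[p]) ^ r * (c : ℚ_[p]) := by
      have := congrArg (fun z : ℤ_[p] => (z : ℚ_[p])) hc
      simpa [hz] using this
    refine ⟨⟨z.appr r, z.appr_lt r⟩, Subtype.ext (Subtype.ext ?_)⟩
    refine (fracReps_eq_of_norm_sub_le_one (p := p) hn (hq _) ?_).symm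
    have h1 : (n : ℚ_[p]) - (y + (z.appr r : ℚ_[p]) / (p : ℚ_[p]) ^ r) = c := by
      field_simp
      linear_combination hc'
    have h2 := norm_add_le_one (h1 ▸ c.2) (hqn (y + (z.appr r : ℚ_[p]) / (p : ℚ_[p]) ^ r))
    convert h2 using 2
    ring

/-- The affine map `x ↦ p^γ (x + n)`. -/
def gridAff (γ : ℤ) (n : ℚ) : Aff p := ⟨pPow p γ, (pPow p γ : ℚ_[p]) * (n : ℚ_[p])⟩

theorem waveletFamily_apply (F : Finset (ℚ_[p] → ℂ)) (t : ℤ × FracReps p × F) :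
    waveletFamily F t = gridAff (p := p) t.1 t.2.1 • (t.2.2 : ℚ_[p] → ℂ) := rfl

theorem norm_pPow (γ : ℤ) : ‖(pPow p γ : ℚ_[p])‖ = (p : ℝ) ^ (-γ) := by
  rw [pPow, Units.val_zpow_eq_zpow_val, Units.val_mk0, Padic.norm_p_zpow]

/-- Describes the grid points (γ, n) with g in `gridAff γ n` * R * K, for R the dilation of norm p^r
and K = `ballGroup p`: the scale is forced, and the shift is free in a ball of radius p^r. -/
theorem dilation_inv_mul_mem_iff (g : Aff p) (γ : ℤ) (n : ℚ) (r : ℕ) :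
    (⟨pPow p (-r), 0⟩ : Aff p)⁻¹ * ((gridAff γ n)⁻¹ * g) ∈ ballGroup p ↔
      γ = (g.a : ℚ_[p]).valuation + r ∧
        ‖((pPow p γ)⁻¹ : ℚ_[p]) * g.b - (n : ℚ_[p])‖ ≤ (p : ℝ) ^ r := by
  have hpr : (0 : ℝ) < (p : ℝ) ^ r := pow_pos (by exact_mod_cast hp.out.pos) r
  have hpr0 : (0 : ℝ) < p := by exact_mod_cast hp.out.pos
  have hr : ‖((pPow p (-r) : ℚ_[p]ˣ) : ℚ_[p])‖ = (p : ℝ) ^ r := by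
    rw [norm_pPow, neg_neg, zpow_natCast]
  rw [mem_ballGroup]
  have ha : ‖((((⟨pPow p (-r), 0⟩ : Aff p)⁻¹ * ((gridAff γ n)⁻¹ * g)).a : ℚ_[p]ˣ) : ℚ_[p])‖ =
      (p : ℝ) ^ (-(r : ℤ) + (γ - (g.a : ℚ_[p]).valuation)) := by
    simp only [Aff.mul_a, Aff.inv_a, gridAff, Units.val_mul, Units.val_inv_eq_inv_val, norm_mul,
      norm_inv]
    rw [hr, norm_pPow, Padic.norm_eq_zpow_neg_valuation g.a.ne_zero, ← zpow_natCast, ← zpow_neg,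
      ← zpow_neg, neg_neg, ← zpow_add₀ hpr0.ne', ← zpow_add₀ hpr0.ne', sub_eq_add_neg]
  have hb : ‖((⟨pPow p (-r), 0⟩ : Aff p)⁻¹ * ((gridAff γ n)⁻¹ * g)).b‖ =
      ((p : ℝ) ^ r)⁻¹ * ‖((pPow p γ)⁻¹ : ℚ_[p]) * g.b - (n : ℚ_[p])‖ := by
    have : ((⟨pPow p (-r), 0⟩ : Aff p)⁻¹ * ((gridAff γ n)⁻¹ * g)).b =
        ((pPow p (-r) : ℚ_[p]ˣ) : ℚ_[p])⁻¹ *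
          (((pPow p γ)⁻¹ : ℚ_[p]) * g.b - (n : ℚ_[p])) := by
      have := (pPow p γ).ne_zero
      simp only [Aff.mul_b, Aff.inv_b, Aff.inv_a, gridAff, Units.val_inv_eq_inv_val]
      field_simp
      ring
    rw [this, norm_mul, norm_inv, hr]
  rw [ha, hb, inv_mul_le_iff₀ hpr, mul_one,
    zpow_eq_one_iff_right₀ hpr0.le (one_lt_p (p := p)).ne']
  refine and_congr_left fun _ => ⟨fun h => by omega, fun h => by omega⟩

theorem finite_ballGroup_orbit {w : ℚ_[p] → ℂ} {n : ℕ}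
    (hw : congruenceGroup p n ≤ MulAction.stabilizer (Aff p) w) :
    {φ | ∃ k ∈ ballGroup p, φ = k • w}.Finite := by
  have := finite_ballGroup_quotient (p := p) n
  refine (Set.finite_range fun q : ballGroup p ⧸ (congruenceGroup p n).subgroupOf (ballGroup p) =>
    (q.out : Aff p) • w).subset ?_
  rintro _ ⟨k, hk, rfl⟩
  refine ⟨((⟨k, hk⟩ : ballGroup p) : _ ⧸ (congruenceGroup p n).subgroupOf (ballGroup p)), ?_⟩
  obtain ⟨⟨y, hy⟩, hy'⟩ := QuotientGroup.mk_out_eq_mul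
    ((congruenceGroup p n).subgroupOf (ballGroup p)) ⟨k, hk⟩
  have h1 := MulAction.mem_stabilizer_iff.1 (hw (Subgroup.mem_subgroupOf.1 hy))
  change ((Quotient.out _ : ballGroup p) : Aff p) • w = k • w
  rw [hy', Subgroup.coe_mul, mul_smul, h1]

/-- The orbit of a function whose stabilizer preserves the unit ball, enumerated by scale, shift
and a finite set of functions, each element occurring `p ^ r` times. -/
theorem exists_isCopies {w : ℚ_[p] → ℂ} {n : ℕ}
    (hw : congruenceGroup p n ≤ MulAction.stabilizer (Aff p) w)
    (hst : MulAction.stabilizer (Aff p) w ≤ ballGroup p) (r : ℕ) :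
    ∃ F : Finset (ℚ_[p] → ℂ), (∀ φ ∈ F, φ ∈ MulAction.orbit (Aff p) w) ∧
      IsCopies (p ^ r) (waveletFamily F) (MulAction.orbit (Aff p) w) := by
  set R : Aff p := ⟨pPow p (-r), 0⟩ with hR
  have hfin : {φ | ∃ k ∈ ballGroup p, φ = R • k • w}.Finite := by
    refine ((finite_ballGroup_orbit hw).image (R • ·)).subset ?_
    rintro _ ⟨k, hk, rfl⟩
    exact ⟨_, ⟨k, hk, rfl⟩, rfl⟩
  have hF : ∀ φ, φ ∈ hfin.toFinset ↔ ∃ k ∈ ballGroup p, φ = R • k • w := fun φ => by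
    rw [Set.Finite.mem_toFinset, Set.mem_ofPred_eq]
  have horb : ∀ φ ∈ hfin.toFinset, φ ∈ MulAction.orbit (Aff p) w := by
    intro φ hφ
    obtain ⟨k, -, rfl⟩ := (hF φ).1 hφ
    exact ⟨R * k, mul_smul _ _ _⟩
  refine ⟨hfin.toFinset, horb, isCopies_of_fiber (fun t => ?_) ?_⟩
  · rw [waveletFamily_apply]
    obtain ⟨k, hk⟩ := horb _ t.2.2.2
    exact ⟨gridAff t.1 t.2.1 * k, by rw [← hk]; exact mul_smul _ _ _⟩
  · rintro _ ⟨g, rfl⟩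
    obtain ⟨e⟩ := nonempty_fracReps_ball_equiv
      (((pPow p ((g.a : ℚ_[p]).valuation + r))⁻¹ : ℚ_[p]) * g.b) r
    -- An equality of functions determines the group element up to the stabilizer of w, which lies
    -- in `ballGroup p`; it thus becomes the coset condition of `dilation_inv_mul_mem_iff`.
    have key : ∀ t : ℤ × FracReps p × hfin.toFinset, waveletFamily hfin.toFinset t = g • w →
        t.1 = (g.a : ℚ_[p]).valuation + r ∧
        ‖((pPow p t.1)⁻¹ : ℚ_[p]) * g.b - ((t.2.1 : ℚ) : ℚ_[p])‖ ≤ (p : ℝ) ^ r := by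
      rintro ⟨γ, n, φ, hφ⟩ ht
      rw [← dilation_inv_mul_mem_iff, ← hR]
      obtain ⟨k, hk, rfl⟩ := (hF φ).1 hφ
      rw [waveletFamily_apply] at ht
      change gridAff γ (n : ℚ) • R • k • w = g • w at ht
      have h1 : k⁻¹ * (R⁻¹ * ((gridAff γ (n : ℚ))⁻¹ * g)) ∈ MulAction.stabilizer (Aff p) w := by
        rw [MulAction.mem_stabilizer_iff, mul_smul, mul_smul, mul_smul, ← ht, inv_smul_smul,
          inv_smul_smul, inv_smul_smul]
      have h2 := (ballGroup p).mul_mem hk (hst h1)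
      rwa [mul_inv_cancel_left] at h2
    -- The occurrences of g • w are parametrized by n alone: γ is forced by g, and φ is recovered
    -- from (γ, n) by inverting the grid map.
    refine ⟨(Equiv.ofBijective (fun t : {t // waveletFamily hfin.toFinset t = g • w} =>
      (⟨t.1.2.1, by obtain ⟨h1, h2⟩ := key t.1 t.2; rwa [h1] at h2⟩ :
        {n : FracReps p // ‖((pPow p ((g.a : ℚ_[p]).valuation + r))⁻¹ : ℚ_[p]) * g.b -
          ((n : ℚ) : ℚ_[p])‖ ≤ (p : ℝ) ^ r})) ⟨?_, ?_⟩).trans e⟩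
    · rintro ⟨⟨γ, n, φ⟩, ht⟩ ⟨⟨γ', n', φ'⟩, ht'⟩ h
      obtain rfl : n = n' := congrArg Subtype.val h
      have h1 := (key _ ht).1
      have h2 := (key _ ht').1
      simp only at h1 h2
      subst h1
      subst h2
      rw [waveletFamily_apply] at ht ht'
      have h3 := smul_left_cancel _ (ht.trans ht'.symm)
      simp only at h3
      obtain rfl := Subtype.ext h3
      rfl
    · rintro ⟨n, hn⟩
      have h1 := (dilation_inv_mul_mem_iff g ((g.a : ℚ_[p]).valuation + r) n r).2 ⟨rfl, hn⟩
      rw [← hR] at h1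
      refine ⟨⟨⟨(g.a : ℚ_[p]).valuation + r, n,
        ⟨(gridAff (p := p) ((g.a : ℚ_[p]).valuation + r) (n : ℚ))⁻¹ • g • w,
          (hF _).2 ⟨_, h1, ?_⟩⟩⟩, ?_⟩, rfl⟩
      · rw [mul_smul, mul_smul, smul_inv_smul]
      · rw [waveletFamily_apply]
        exact smul_inv_smul (gridAff (p := p) ((g.a : ℚ_[p]).valuation + r) (n : ℚ)) (g • w)

/-! ### Assembly -/

/-- The orbit of a nonzero combination of wavelets, each element taken `p ^ r` times, is a uniform
tight frame of wavelets. The stabilizer of a dilate of `f` supported in the unit ball always preserves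
this ball, so neither genericity nor a bound on `r` is needed. -/
theorem exists_frame_orbit {f : ℚ_[p] → ℂ} (hf0 : f ≠ 0) {C : WaveletIndex p →₀ ℂ}
    (hC : f = waveletSum p C) (r : ℕ) :
    ∃ F : Finset (ℚ_[p] → ℂ), IsWaveletFrame F ∧ IsUniformTightFrameL2 (waveletFamily F) ∧
      IsCopies (p ^ r) (waveletFamily F) (orbit f) := by
  choose k hk using exists_wavelet_eq_wav (p := p)
  have hf : f = ∑ i ∈ C.support, C i • wav (k i) := by
    rw [hC]
    funext x
    rw [waveletSum, Finset.sum_apply]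
    exact Finset.sum_congr rfl fun i _ => by rw [hk i, Pi.smul_apply, smul_eq_mul]
  obtain ⟨g, t, d, h, hg, hM, hsep⟩ := exists_smul_sum_eq_wavComb C.support C k
  rw [← hf] at hg
  have h0 : wavComb d h ≠ 0 := by
    rw [← hg]
    intro h1
    apply hf0
    rw [← inv_smul_smul g f, h1]
    funext x
    rw [smul_apply', Pi.zero_apply, mul_zero, Pi.zero_apply]
  have horb : orbit f = MulAction.orbit (Aff p) (wavComb d h) := by
    rw [orbit_eq, ← hg, MulAction.orbit_eq_iff.2 (MulAction.mem_orbit f g)]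
  obtain ⟨n, hn⟩ := exists_level_lt h
  obtain ⟨F, hF, hcop⟩ := exists_isCopies (congruenceGroup_le_stabilizer (d := d) hM hn)
    (stabilizer_le_ballGroup (continuous_wavComb d h) h0 fun x hx => wavComb_eq_zero_of_lt hM hx) r
  have htight := hcop.isUniformTightFrameL2 (pow_pos hp.out.pos r)
    (isUniformTightFrame_orbit hM hsep h0)
  refine ⟨F, ⟨fun φ hφ => ?_, htight.isFrameL2⟩, htight, horb ▸ hcop⟩
  obtain ⟨s, rfl⟩ := exists_eq_wavComb_of_mem_orbit (hF φ hφ)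
  exact ⟨memLp_wavComb _ _, integrable_wavComb _ _, integral_wavComb _ _⟩

end

end PadicWavelet

theorem mainTheorem5 (p : ℕ) [Fact p.Prime] (f : ℚ_[p] → ℂ)
    (hf : f ∈ PadicWavelet.MeanZeroTestFunctions p) (hf0 : f ≠ 0)
    (C : PadicWavelet.WaveletIndex p →₀ ℂ) (hgen : PadicWavelet.IsGeneric f C)
    (γ₀ : ℤ) (hγ₀ : IsLeast {γ : ℤ | ∃ i ∈ C.support, i.1 = γ} γ₀) :
    (γ₀ ≤ 1 ∧ ∃ F : Finset (ℚ_[p] → ℂ),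
      PadicWavelet.IsWaveletFrame F ∧
      PadicWavelet.IsUniformTightFrameL2 (PadicWavelet.waveletFamily F) ∧
      Function.Injective (PadicWavelet.waveletFamily F) ∧
      Set.range (PadicWavelet.waveletFamily F) = PadicWavelet.orbit f) ∨
    (1 < γ₀ ∧ ∃ F : Finset (ℚ_[p] → ℂ),
      PadicWavelet.IsWaveletFrame F ∧
      PadicWavelet.IsUniformTightFrameL2 (PadicWavelet.waveletFamily F) ∧
      PadicWavelet.IsCopies (p ^ (γ₀ - 1).toNat) (PadicWavelet.waveletFamily F)
        (PadicWavelet.orbit f)) := by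
  obtain ⟨F, hF, hF', hcop⟩ :=
    PadicWavelet.exists_frame_orbit hf0 hgen.1 (γ₀ - 1).toNat
  rcases le_or_gt γ₀ 1 with h | h
  -- Here γ₀ - 1 ≤ 0 is truncated to the exponent 0, so each element of the orbit occurs exactly
  -- once.
  · rw [Int.toNat_of_nonpos (by omega), pow_zero] at hcop
    exact Or.inl ⟨h, F, hF, hF', hcop.injective_and_range⟩
  · exact Or.inr ⟨h, F, hF, hF', hcop⟩
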